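/- Let $X_1,X_2,\dots$ be i.i.d. random variables with values in $[-\pi,\pi)$ (a circular distribution) and distribution function $F(\theta)=P(X_i\le\theta)$ on $[-\pi,\pi)$, with $F(-\pi)=0$. Assume (F): $F$ is twice continuously differentiable on $[-\pi,\pi)$ (one-sided at $-\pi$), where the density $f=F'$ is continuous on the circle, i.e. $f(\theta)\to f(-\pi)$ as $\theta\uparrow\pi$, and $\int_{-\pi}^{\pi}f'(\theta)^2\,d\theta<\infty$. (For instance, both conditions hold if the $2\pi$-periodic extension of $f$ is continuously differentiable.) Let $K_m(s)=\frac1{2\pi}+\frac1\pi\sum_{k=1}^m\bigl(1-\frac{k}{m+1}\bigr)\cos(ks)$ be the Fejér kernel, and $$\hat F_{m,n}(\theta)=\int_{-\pi}^{\theta}\frac1n\sum_{j=1}^nK_m(y-X_j)\,dy,\qquad \mathrm{MISE}(F;\hat F_{m,n})=E\int_{-\pi}^{\pi}\bigl(\hat F_{m,n}(\theta)-F(\theta)\bigr)^2d\theta .$$ With $a_k=\int_{-\pi}^{\pi}f(\theta)\cos(k\theta)\,d\theta$ and $b_k=\int_{-\pi}^{\pi}f(\theta)\sin(k\theta)\,d\theta$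 put $$\theta_2(F)=\frac1\pi\sum_{k=1}^\infty(a_k^2+b_k^2)+\frac2\pi\sum_{k,l=1}^\infty(-1)^{k+l}b_kb_l ,$$ $$\mathrm{AMISE}(m,n)=\frac1n\int_{-\pi}^{\pi}F(\theta)(1-F(\theta))\,d\theta+R_{m,n},\qquad R_{m,n}=-\frac{2\log m}{\pi mn}\bigl(1+2\pi F'(-\pi)\bigr)+\frac{\theta_2(F)}{m^2}.$$ Then: 1. The two series defining $\theta_2(F)$ converge (absolutely). 2. If $m=m(n)\in\mathbb N$ satisfies $m\to\infty$ and $n/m\to\infty$ as $n\to\infty$, then $\mathrm{AMISE}(m,n)$ is the asymptotic mean integrated squared error of $\hat F_{m,n}$, that is, $$\mathrm{MISE}(F;\hat F_{m,n})=\frac1n\int_{-\pi}^{\pi}F(\theta)(1-F(\theta))\,d\theta+R_{m,n}+o\!\left(\frac{\log m}{mn}+\frac1{m^2}\right)\qquad(n\to\infty).$$ 3. For every integer $n\ge1$, the function $m\mapsto\mathrm{AMISE}(m,n)$ of a real variable $m>0$ has exactly one minimizer. A number $m>0$ is this minimizer if and only if $$\bigl(1+2\pi F'(-\pi)\bigr)\,m(\log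 m-1)=\pi\,\theta_2(F)\,n .$$ If $\theta_2(F)\ne0$ and $c=\pi\theta_2(F)/(1+2\pi F'(-\pi))$, the minimizer is $$m_{\mathrm{opt}}=\frac{cn}{W_0(cn/e)},$$ where $W_0$ is the principal branch of the Lambert W function (the inverse of $w\mapsto we^w$ on $[-1,\infty)$). -/

import Mathlib

open Set Filter Topology MeasureTheory ProbabilityTheory Asymptotics

noncomputable section

namespace FejerCDF

/-- The Fejér kernel of order `m`,
`K_m(s) = 1/(2π) + (1/π) ∑_{k=1}^m (1 - k/(m+1)) cos(ks)`. -/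
def fejerKernel (m : ℕ) (s : ℝ) : ℝ :=
  1 / (2 * Real.pi) +
    1 / Real.pi * ∑ k ∈ Finset.Icc 1 m, (1 - (k : ℝ) / ((m : ℝ) + 1)) * Real.cos ((k : ℝ) * s)

/-- The Fejér density estimator at `θ`, from the sample `x 0, …, x (n - 1)`. -/
def densityEstimator (m n : ℕ) (x : ℕ → ℝ) (θ : ℝ) : ℝ :=
  1 / (n : ℝ) * ∑ j ∈ Finset.range n, fejerKernel m (θ - x j)

/-- The Fejér distribution function estimator at `θ`: the integral of the density estimator
over `[-π, θ]`. -/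
def cdfEstimator (m n : ℕ) (x : ℕ → ℝ) (θ : ℝ) : ℝ :=
  ∫ y in (-Real.pi)..θ, densityEstimator m n x y

/-- The mean integrated squared error `E ∫_{-π}^{π} (F̂_{m,n}(θ) - F(θ))² dθ`. -/
def cdfMISE {Ω : Type*} [MeasurableSpace Ω] (P : Measure Ω) (X : ℕ → Ω → ℝ) (F : ℝ → ℝ)
    (m n : ℕ) : ℝ :=
  ∫ ω, (∫ θ in (-Real.pi)..Real.pi,
    (cdfEstimator m n (fun j => X j ω) θ - F θ) ^ 2) ∂P

/-- The derivative of `F` as a function on `[-π, π)`; it is one-sided at `-π`. -/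
def density (F : ℝ → ℝ) (θ : ℝ) : ℝ :=
  derivWithin F (Ico (-Real.pi) Real.pi) θ

/-- The cosine moments `a_k` of the density `F'`. -/
def cosMoment (F : ℝ → ℝ) (k : ℕ) : ℝ :=
  ∫ θ in (-Real.pi)..Real.pi, density F θ * Real.cos ((k : ℝ) * θ)

/-- The sine moments `b_k` of the density `F'`. -/
def sinMoment (F : ℝ → ℝ) (k : ℕ) : ℝ :=
  ∫ θ in (-Real.pi)..Real.pi, density F θ * Real.sin ((k : ℝ) * θ)

/-- The term of index `k + 1` of the series `∑_{k ≥ 1} (a_k² + b_k²)`. -/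
def theta2Single (F : ℝ → ℝ) (k : ℕ) : ℝ :=
  cosMoment F (k + 1) ^ 2 + sinMoment F (k + 1) ^ 2

/-- The term of index `(k + 1, l + 1)` of the double series
`∑_{k,l ≥ 1} (-1)^{k+l} b_k b_l`. -/
def theta2Double (F : ℝ → ℝ) (p : ℕ × ℕ) : ℝ :=
  (-1 : ℝ) ^ ((p.1 + 1) + (p.2 + 1)) * (sinMoment F (p.1 + 1) * sinMoment F (p.2 + 1))

/-- `θ₂(F) = (1/π) ∑_{k≥1} (a_k² + b_k²) + (2/π) ∑_{k,l≥1} (-1)^{k+l} b_k b_l`. -/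
def theta2 (F : ℝ → ℝ) : ℝ :=
  1 / Real.pi * (∑' k : ℕ, theta2Single F k) + 2 / Real.pi * (∑' p : ℕ × ℕ, theta2Double F p)

/-- `R_{m,n} = - (2 log m / (π m n)) (1 + 2π F'(-π)) + θ₂(F) / m²`, for real `m` and `n`. -/
def remainder (F : ℝ → ℝ) (m n : ℝ) : ℝ :=
  -(2 * Real.log m / (Real.pi * m * n)) * (1 + 2 * Real.pi * density F (-Real.pi))
    + theta2 F / m ^ 2

/-- The asymptotic mean integrated squared error `(1/n) ∫_{-π}^{π} F (1 - F) + R_{m,n}`,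
for real `m` and `n`. -/
def cdfAMISE (F : ℝ → ℝ) (m n : ℝ) : ℝ :=
  1 / n * (∫ θ in (-Real.pi)..Real.pi, F θ * (1 - F θ)) + remainder F m n

/-- The principal branch of the Lambert W function, the inverse of the bijection
`w ↦ w eʷ` from `[-1, ∞)` onto `[-1/e, ∞)`. -/
def lambertW0 : ℝ → ℝ :=
  Function.invFunOn (fun w : ℝ => w * Real.exp w) (Ici (-1))

end FejerCDF

end

noncomputable section

namespace FejerCDF

/-! One sample point x contributes θ ↦ ∫_{-π}^θ K_m(y - x) dy, a linear function plus a
trigonometric polynomial in θ (`fejerCdf`). Integrals over the circle are thus computed exactly by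
Parseval (`hasSum_sq_coeff`, `hasSum_mul_coeff`), in terms of the defect d_k = min(1/(m+1), 1/k) by
which the Fejér weight over k falls short of 1/k. In the code the index k stands for frequency k +
1. By Fubini and independence the MISE is the integrated variance over n plus the integrated squared
bias (`cdfMISE_eq`).

Bias: its Fourier coefficients are d_k b_k and -d_k a_k, with constant coefficient 2 ∑ d_k
(-1)^(k+1) b_k. As (m+1) d_k is at most 1 and eventually equal to 1, dominated convergence shows
that m² times the integrated squared bias tends to θ₂; the double series in θ₂ is the square of ∑
(-1)^k b_k. This needs ∑ |b_k| < ∞, which holds because b_k is 1/k times a Fourier coefficient of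
the square integrable f'.

Variance: the integrated second moment minus ∫ F consists of sums ∑ d_k u_k, apart from terms
quadratic in the defect. Such a sum is O(1/m) if ∑ |u_k| < ∞, but log m / m + O(1/m) for u_k = 1/k.
The case 1/k occurs twice: in squaring the weights 1/k - d_k, and through the jump 2π f(-π) of x
f(x) across the cut. Hence the factor 1 + 2π F'(-π) (`exists_abs_integral_fejerCdf_sq_sub_le`). All
other errors of the variance are O(1/(mn)), negligible against log m / (mn).

Minimizer: the m-derivative of the AMISE has the sign of (1 + 2π F'(-π)) m (log m - 1) - π θ₂ n, and
m (log m - 1) crosses every level t ≥ 0 exactly once (`exists_mul_log_sub_one_eq`), from below. -/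

/-! ### Real Fourier coefficients and Parseval's identity. -/

/-- The cosine coefficient `∫ g(x) cos(kx) dx` over `[-π, π]`. -/
def cosCoeff (g : ℝ → ℝ) (k : ℕ) : ℝ :=
  ∫ x in (-Real.pi)..Real.pi, g x * Real.cos ((k : ℝ) * x)

/-- The sine coefficient `∫ g(x) sin(kx) dx` over `[-π, π]`. -/
def sinCoeff (g : ℝ → ℝ) (k : ℕ) : ℝ :=
  ∫ x in (-Real.pi)..Real.pi, g x * Real.sin ((k : ℝ) * x)

/-- Square integrability on `(-π, π]`. -/
abbrev SqInt (g : ℝ → ℝ) : Prop :=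
  MemLp g 2 (volume.restrict (Ioc (-Real.pi) Real.pi))

lemma neg_pi_lt_pi : -Real.pi < Real.pi := by linarith [Real.pi_pos]

lemma SqInt.intervalIntegrable {g : ℝ → ℝ} (hg : SqInt g) :
    IntervalIntegrable g volume (-Real.pi) Real.pi := by
  rw [intervalIntegrable_iff_integrableOn_Ioc_of_le neg_pi_lt_pi.le]
  exact hg.integrable (by norm_num)

lemma SqInt.intervalIntegrable_mul {g h : ℝ → ℝ} (hg : SqInt g) (hh : SqInt h) :
    IntervalIntegrable (fun x => g x * h x) volume (-Real.pi) Real.pi := by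
  rw [intervalIntegrable_iff_integrableOn_Ioc_of_le neg_pi_lt_pi.le]
  exact hg.integrable_mul hh

lemma sqInt_of_continuousOn {g : ℝ → ℝ} (hg : ContinuousOn g (Icc (-Real.pi) Real.pi)) :
    SqInt g := by
  obtain ⟨C, hC⟩ := isCompact_Icc.exists_bound_of_continuousOn hg
  refine MemLp.of_bound ((hg.mono Ioc_subset_Icc_self).aestronglyMeasurable measurableSet_Ioc) C ?_
  exact (ae_restrict_mem measurableSet_Ioc).mono fun x hx => hC x (Ioc_subset_Icc_self hx)

lemma intervalIntegrable_ofReal {g : ℝ → ℝ} {a b : ℝ} (hg : IntervalIntegrable g volume a b) :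
    IntervalIntegrable (fun x => (g x : ℂ)) volume a b :=
  ⟨hg.1.ofReal, hg.2.ofReal⟩

lemma cosCoeff_zero (g : ℝ → ℝ) : cosCoeff g 0 = ∫ x in (-Real.pi)..Real.pi, g x := by
  simp [cosCoeff]

lemma fourierCoeffOn_ofReal {g : ℝ → ℝ} (hg : SqInt g) (k : ℕ) :
    fourierCoeffOn neg_pi_lt_pi (fun x => (g x : ℂ)) (k : ℤ) =
      (1 / (2 * Real.pi) : ℝ) * ((cosCoeff g k : ℂ) - Complex.I * (sinCoeff g k : ℂ)) ∧
    fourierCoeffOn neg_pi_lt_pi (fun x => (g x : ℂ)) (-(k : ℤ)) =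
      (1 / (2 * Real.pi) : ℝ) * ((cosCoeff g k : ℂ) + Complex.I * (sinCoeff g k : ℂ)) := by
  have hi := hg.intervalIntegrable
  have hc : IntervalIntegrable (fun x => ((g x * Real.cos (k * x) : ℝ) : ℂ)) volume
      (-Real.pi) Real.pi :=
    intervalIntegrable_ofReal (hi.mul_continuousOn (by fun_prop))
  have hs : IntervalIntegrable (fun x => Complex.I * ((g x * Real.sin (k * x) : ℝ) : ℂ)) volume
      (-Real.pi) Real.pi :=
    (intervalIntegrable_ofReal (hi.mul_continuousOn (by fun_prop))).const_mul _
  have hpi : (Real.pi : ℂ) ≠ 0 := by exact_mod_cast Real.pi_ne_zero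
  have e1 : ∀ x : ℝ, 2 * (Real.pi : ℂ) * Complex.I * k * x / ((Real.pi : ℂ) - -Real.pi)
      = ((k : ℂ) * x) * Complex.I := by
    intro x; field_simp; ring
  constructor
  · rw [fourierCoeffOn_eq_integral, cosCoeff, sinCoeff, ← intervalIntegral.integral_ofReal,
      ← intervalIntegral.integral_ofReal, ← intervalIntegral.integral_const_mul,
      ← intervalIntegral.integral_sub hc hs]
    rw [show Real.pi - -Real.pi = 2 * Real.pi by ring, Complex.real_smul]
    congr 1
    apply intervalIntegral.integral_congr
    intro x _
    simp only [fourier_coe_apply, smul_eq_mul]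
    rw [show 2 * (Real.pi : ℂ) * Complex.I * ((-(k : ℤ) : ℤ) : ℂ) * x / ((2 * Real.pi : ℝ) : ℂ)
      = (((-(k * x) : ℝ)) : ℂ) * Complex.I by push_cast; field_simp]
    rw [Complex.exp_mul_I, ← Complex.ofReal_cos, ← Complex.ofReal_sin, Real.cos_neg, Real.sin_neg]
    push_cast
    ring
  · rw [fourierCoeffOn_eq_integral, cosCoeff, sinCoeff, ← intervalIntegral.integral_ofReal,
      ← intervalIntegral.integral_ofReal, ← intervalIntegral.integral_const_mul,
      ← intervalIntegral.integral_add hc hs]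
    rw [show Real.pi - -Real.pi = 2 * Real.pi by ring, Complex.real_smul]
    congr 1
    apply intervalIntegral.integral_congr
    intro x _
    simp only [fourier_coe_apply, smul_eq_mul]
    rw [show 2 * (Real.pi : ℂ) * Complex.I * ((- -(k : ℤ) : ℤ) : ℂ) * x / ((2 * Real.pi : ℝ) : ℂ)
      = (((k * x : ℝ)) : ℂ) * Complex.I by push_cast; field_simp]
    rw [Complex.exp_mul_I, ← Complex.ofReal_cos, ← Complex.ofReal_sin]
    push_cast
    ring

/-- Parseval's identity for the real Fourier coefficients on `[-π, π]`. -/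
lemma hasSum_sq_coeff {g : ℝ → ℝ} (hg : SqInt g) :
    HasSum (fun k : ℕ => cosCoeff g (k + 1) ^ 2 + sinCoeff g (k + 1) ^ 2)
      (Real.pi * (∫ x in (-Real.pi)..Real.pi, g x ^ 2) - cosCoeff g 0 ^ 2 / 2) := by
  have hpi := Real.pi_pos
  have h := hasSum_sq_fourierCoeffOn neg_pi_lt_pi (f := fun x => (g x : ℂ)) hg.ofReal
  -- Pairing the frequencies k and -k counts k = 0 twice; removing the whole term k = 0 afterwards
  -- leaves the correction -a_0²/2.
  have h2 := h.nat_add_neg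
  have hn : ∀ k : ℕ, ‖fourierCoeffOn neg_pi_lt_pi (fun x => (g x : ℂ)) (k : ℤ)‖ ^ 2 +
      ‖fourierCoeffOn neg_pi_lt_pi (fun x => (g x : ℂ)) (-(k : ℤ))‖ ^ 2 =
      (1 / (2 * Real.pi ^ 2)) * (cosCoeff g k ^ 2 + sinCoeff g k ^ 2) := by
    intro k
    rw [(fourierCoeffOn_ofReal hg k).1, (fourierCoeffOn_ofReal hg k).2, Complex.sq_norm,
      Complex.sq_norm]
    simp only [Complex.normSq_apply, Complex.mul_re, Complex.mul_im, Complex.ofReal_re,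
      Complex.ofReal_im, Complex.sub_re, Complex.sub_im, Complex.add_re, Complex.add_im,
      Complex.I_re, Complex.I_im]
    field_simp
    ring
  have h0 : ‖fourierCoeffOn neg_pi_lt_pi (fun x => (g x : ℂ)) 0‖ ^ 2 =
      (1 / (4 * Real.pi ^ 2)) * cosCoeff g 0 ^ 2 := by
    have := (fourierCoeffOn_ofReal hg 0).1
    have hs : sinCoeff g 0 = 0 := by simp [sinCoeff]
    rw [hs] at this
    simp only [Nat.cast_zero] at this
    rw [this, Complex.sq_norm]
    simp only [Complex.normSq_apply, Complex.mul_re, Complex.mul_im, Complex.ofReal_re,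
      Complex.ofReal_im, Complex.sub_re, Complex.sub_im,
      Complex.I_re, Complex.I_im]
    field_simp
    ring
  simp only [hn, h0] at h2
  have h3 := h2.mul_left (2 * Real.pi ^ 2)
  have h4 := (hasSum_nat_add_iff' 1).2 h3
  convert! h4 using 1
  · funext k
    field_simp
  · simp only [Complex.norm_real, Real.norm_eq_abs, sq_abs, smul_eq_mul, Finset.range_one,
      Finset.sum_singleton]
    have hs : sinCoeff g 0 = 0 := by simp [sinCoeff]
    rw [hs]
    field_simp
    ring

lemma cosCoeff_add {g h : ℝ → ℝ} (hg : SqInt g) (hh : SqInt h) (k : ℕ) :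
    cosCoeff (g + h) k = cosCoeff g k + cosCoeff h k := by
  unfold cosCoeff
  rw [← intervalIntegral.integral_add (hg.intervalIntegrable.mul_continuousOn (by fun_prop))
    (hh.intervalIntegrable.mul_continuousOn (by fun_prop))]
  simp [add_mul]

lemma sinCoeff_add {g h : ℝ → ℝ} (hg : SqInt g) (hh : SqInt h) (k : ℕ) :
    sinCoeff (g + h) k = sinCoeff g k + sinCoeff h k := by
  unfold sinCoeff
  rw [← intervalIntegral.integral_add (hg.intervalIntegrable.mul_continuousOn (by fun_prop))
    (hh.intervalIntegrable.mul_continuousOn (by fun_prop))]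
  simp [add_mul]

/-- The bilinear form of Parseval's identity. -/
lemma hasSum_mul_coeff {g h : ℝ → ℝ} (hg : SqInt g) (hh : SqInt h) :
    HasSum (fun k : ℕ => cosCoeff g (k + 1) * cosCoeff h (k + 1) +
        sinCoeff g (k + 1) * sinCoeff h (k + 1))
      (Real.pi * (∫ x in (-Real.pi)..Real.pi, g x * h x) - cosCoeff g 0 * cosCoeff h 0 / 2) := by
  have h1 := ((hasSum_sq_coeff (hg.add hh)).sub ((hasSum_sq_coeff hg).add
    (hasSum_sq_coeff hh))).div_const 2
  have hgg := hg.intervalIntegrable_mul hg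
  have hhh := hh.intervalIntegrable_mul hh
  have hgh := hg.intervalIntegrable_mul hh
  have e : (∫ x in (-Real.pi)..Real.pi, (g + h) x ^ 2) =
      (∫ x in (-Real.pi)..Real.pi, g x ^ 2) + (∫ x in (-Real.pi)..Real.pi, h x ^ 2) +
        2 * ∫ x in (-Real.pi)..Real.pi, g x * h x := by
    simp only [sq]
    rw [← intervalIntegral.integral_const_mul, ← intervalIntegral.integral_add hgg hhh,
      ← intervalIntegral.integral_add (hgg.add hhh) (hgh.const_mul 2)]
    apply intervalIntegral.integral_congr
    intro x _
    simp only [Pi.add_apply]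
    ring
  convert! h1 using 1
  · funext k
    rw [cosCoeff_add hg hh, sinCoeff_add hg hh]
    ring
  · rw [e, cosCoeff_add hg hh]
    ring

/-! ### Parity, orthogonality and integration by parts. -/

lemma cosCoeff_eq_zero_of_odd {g : ℝ → ℝ} (hg : ∀ x, g (-x) = -g x) (k : ℕ) :
    cosCoeff g k = 0 := by
  have h := intervalIntegral.integral_comp_neg (a := -Real.pi) (b := Real.pi)
    (fun x => g x * Real.cos ((k : ℝ) * x))
  simp only [hg, mul_neg, Real.cos_neg, neg_mul, neg_neg, intervalIntegral.integral_neg] at h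
  unfold cosCoeff
  linarith

lemma sinCoeff_eq_zero_of_even {g : ℝ → ℝ} (hg : ∀ x, g (-x) = g x) (k : ℕ) :
    sinCoeff g k = 0 := by
  have h := intervalIntegral.integral_comp_neg (a := -Real.pi) (b := Real.pi)
    (fun x => g x * Real.sin ((k : ℝ) * x))
  simp only [hg, mul_neg, Real.sin_neg, neg_neg, intervalIntegral.integral_neg] at h
  unfold sinCoeff
  linarith

lemma integral_cos_int_mul (n : ℤ) :
    ∫ x in (-Real.pi)..Real.pi, Real.cos ((n : ℝ) * x) = if n = 0 then 2 * Real.pi else 0 := by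
  split_ifs with h
  · subst h
    simp
    ring
  · have hn : (n : ℝ) ≠ 0 := by exact_mod_cast h
    rw [intervalIntegral.integral_comp_mul_left (fun x => Real.cos x) hn, integral_cos]
    simp [Real.sin_int_mul_pi]

lemma cosCoeff_cos (j k : ℕ) (hj : j ≠ 0) :
    cosCoeff (fun x => Real.cos ((j : ℝ) * x)) k = if k = j then Real.pi else 0 := by
  have e : ∀ x : ℝ, Real.cos ((j : ℝ) * x) * Real.cos ((k : ℝ) * x) =
      (1 / 2) * (Real.cos ((((k : ℤ) - j : ℤ) : ℝ) * x) +
        Real.cos ((((k : ℤ) + j : ℤ) : ℝ) * x)) := by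
    intro x
    push_cast
    rw [sub_mul, add_mul, Real.cos_sub, Real.cos_add]
    ring
  simp only [cosCoeff, e]
  rw [intervalIntegral.integral_const_mul, intervalIntegral.integral_add
    (Continuous.intervalIntegrable (by fun_prop) _ _)
    (Continuous.intervalIntegrable (by fun_prop) _ _), integral_cos_int_mul, integral_cos_int_mul,
    if_neg (show ¬ ((k : ℤ) + j = 0) by omega)]
  by_cases h : k = j
  · simp [h]
  · rw [if_neg (by omega), if_neg h]
    simp

lemma sinCoeff_sin (j k : ℕ) (hj : j ≠ 0) :
    sinCoeff (fun x => Real.sin ((j : ℝ) * x)) k = if k = j then Real.pi else 0 := by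
  have e : ∀ x : ℝ, Real.sin ((j : ℝ) * x) * Real.sin ((k : ℝ) * x) =
      (1 / 2) * (Real.cos ((((k : ℤ) - j : ℤ) : ℝ) * x) -
        Real.cos ((((k : ℤ) + j : ℤ) : ℝ) * x)) := by
    intro x
    push_cast
    rw [sub_mul, add_mul, Real.cos_sub, Real.cos_add]
    ring
  simp only [sinCoeff, e]
  rw [intervalIntegral.integral_const_mul, intervalIntegral.integral_sub
    (Continuous.intervalIntegrable (by fun_prop) _ _)
    (Continuous.intervalIntegrable (by fun_prop) _ _), integral_cos_int_mul, integral_cos_int_mul,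
    if_neg (show ¬ ((k : ℤ) + j = 0) by omega)]
  by_cases h : k = j
  · simp [h]
  · rw [if_neg (by omega), if_neg h]
    simp

lemma cosCoeff_const (c : ℝ) (k : ℕ) :
    cosCoeff (fun _ => c) k = if k = 0 then 2 * Real.pi * c else 0 := by
  have := integral_cos_int_mul k
  simp only [cosCoeff, intervalIntegral.integral_const_mul]
  push_cast at this
  rw [this]
  split_ifs with h1 h2 h2
  · ring
  · omega
  · omega
  · ring

lemma cos_nat_succ_mul_pi (k : ℕ) : Real.cos (((k + 1 : ℕ) : ℝ) * Real.pi) = -(-1) ^ k := by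
  rw [Real.cos_nat_mul_pi, pow_succ]
  ring

/-- Integration by parts for the cosine coefficients. -/
lemma cosCoeff_eq_of_hasDerivAt {g g' : ℝ → ℝ} (hg : ContinuousOn g (Icc (-Real.pi) Real.pi))
    (hd : ∀ x ∈ Ioo (-Real.pi) Real.pi, HasDerivAt g (g' x) x)
    (hi : IntervalIntegrable g' volume (-Real.pi) Real.pi) (k : ℕ) :
    cosCoeff g (k + 1) = -sinCoeff g' (k + 1) / (k + 1) := by
  have hk : ((k : ℝ) + 1) ≠ 0 := by positivity
  have h := intervalIntegral.integral_mul_deriv_eq_deriv_mul_of_hasDerivAt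
    (a := -Real.pi) (b := Real.pi) (u := g) (u' := g')
    (v := fun x => Real.sin (((k + 1 : ℕ) : ℝ) * x) / (k + 1))
    (v' := fun x => Real.cos (((k + 1 : ℕ) : ℝ) * x))
    (by rwa [uIcc_of_le neg_pi_lt_pi.le]) (by fun_prop)
    (by rwa [min_eq_left neg_pi_lt_pi.le, max_eq_right neg_pi_lt_pi.le])
    (fun x _ => by
      have := ((hasDerivAt_id x).const_mul (((k + 1 : ℕ) : ℝ))).sin.div_const ((k : ℝ) + 1)
      refine this.congr_deriv ?_
      push_cast
      field_simp
      simp) hi (Continuous.intervalIntegrable (by fun_prop) _ _)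
  rw [cosCoeff, h, Real.sin_nat_mul_pi, mul_neg, Real.sin_neg, Real.sin_nat_mul_pi, sinCoeff]
  simp only [← mul_div_assoc, intervalIntegral.integral_div]
  ring

/-- Integration by parts for the sine coefficients. -/
lemma sinCoeff_eq_of_hasDerivAt {g g' : ℝ → ℝ} (hg : ContinuousOn g (Icc (-Real.pi) Real.pi))
    (hd : ∀ x ∈ Ioo (-Real.pi) Real.pi, HasDerivAt g (g' x) x)
    (hi : IntervalIntegrable g' volume (-Real.pi) Real.pi) (k : ℕ) :
    sinCoeff g (k + 1) =
      ((g Real.pi - g (-Real.pi)) * (-1) ^ k + cosCoeff g' (k + 1)) / (k + 1) := by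
  have hk : ((k : ℝ) + 1) ≠ 0 := by positivity
  have h := intervalIntegral.integral_mul_deriv_eq_deriv_mul_of_hasDerivAt
    (a := -Real.pi) (b := Real.pi) (u := g) (u' := g')
    (v := fun x => -Real.cos (((k + 1 : ℕ) : ℝ) * x) / (k + 1))
    (v' := fun x => Real.sin (((k + 1 : ℕ) : ℝ) * x))
    (by rwa [uIcc_of_le neg_pi_lt_pi.le]) (by fun_prop)
    (by rwa [min_eq_left neg_pi_lt_pi.le, max_eq_right neg_pi_lt_pi.le])
    (fun x _ => by
      have := ((hasDerivAt_id x).const_mul (((k + 1 : ℕ) : ℝ))).cos.neg.div_const ((k : ℝ) + 1)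
      refine this.congr_deriv ?_
      push_cast
      field_simp
      simp) hi (Continuous.intervalIntegrable (by fun_prop) _ _)
  rw [sinCoeff, h, mul_neg, Real.cos_neg, cos_nat_succ_mul_pi, cosCoeff]
  simp only [← mul_div_assoc, mul_neg, neg_div, intervalIntegral.integral_neg,
    intervalIntegral.integral_div]
  ring

lemma sinCoeff_id (k : ℕ) :
    sinCoeff (fun x => x) (k + 1) = 2 * Real.pi * (-1) ^ k / (k + 1) := by
  rw [sinCoeff_eq_of_hasDerivAt (g := fun x => x) (g' := fun _ => 1) (by fun_prop)
    (fun x _ => hasDerivAt_id x)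
    (by simp), cosCoeff_const, if_neg (by omega)]
  ring

lemma cosCoeff_sq (k : ℕ) :
    cosCoeff (fun x => x ^ 2) (k + 1) = -4 * Real.pi * (-1) ^ k / (k + 1) ^ 2 := by
  have e : sinCoeff (fun x => 2 * x) (k + 1) = 2 * sinCoeff (fun x => x) (k + 1) := by
    simp only [sinCoeff, ← intervalIntegral.integral_const_mul, mul_assoc]
  rw [cosCoeff_eq_of_hasDerivAt (g' := fun x => 2 * x) (by fun_prop)
    (fun x _ => by simpa using hasDerivAt_pow 2 x)
    (Continuous.intervalIntegrable (by fun_prop) _ _), e, sinCoeff_id]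
  field_simp
  ring

/-! ### Coefficients of a linear function plus a trigonometric polynomial. -/

/-- A linear function plus a trigonometric polynomial. -/
def linearTrig (m : ℕ) (c d : ℝ) (p q : ℕ → ℝ) (x : ℝ) : ℝ :=
  c + d * x + ∑ k ∈ Finset.range m,
    (p k * Real.cos (((k + 1 : ℕ) : ℝ) * x) + q k * Real.sin (((k + 1 : ℕ) : ℝ) * x))

lemma continuous_linearTrig (m : ℕ) (c d : ℝ) (p q : ℕ → ℝ) :
    Continuous (linearTrig m c d p q) := by
  unfold linearTrig
  fun_prop

lemma cosCoeff_linearTrig_expand (m : ℕ) (c d : ℝ) (p q : ℕ → ℝ) (k : ℕ) :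
    cosCoeff (linearTrig m c d p q) k = cosCoeff (fun _ => c) k +
      ∑ j ∈ Finset.range m, p j * (if k = j + 1 then Real.pi else 0) := by
  have h1 : cosCoeff (linearTrig m c d p q) k = cosCoeff (fun _ => c) k +
      d * cosCoeff (fun x => x) k + ∑ j ∈ Finset.range m,
        (p j * cosCoeff (fun x => Real.cos (((j + 1 : ℕ) : ℝ) * x)) k +
          q j * cosCoeff (fun x => Real.sin (((j + 1 : ℕ) : ℝ) * x)) k) := by
    simp only [cosCoeff, ← intervalIntegral.integral_const_mul]
    have hI : ∀ u : ℝ → ℝ, Continuous u → IntervalIntegrable u volume (-Real.pi) Real.pi :=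
      fun u hu => hu.intervalIntegrable _ _
    rw [Finset.sum_congr rfl fun j _ => (intervalIntegral.integral_add (hI _ (by fun_prop))
      (hI _ (by fun_prop))).symm, ← intervalIntegral.integral_finsetSum
      (fun j _ => hI _ (by fun_prop)),
      ← intervalIntegral.integral_add (hI _ (by fun_prop)) (hI _ (by fun_prop)),
      ← intervalIntegral.integral_add (hI _ (by fun_prop)) (hI _ (by fun_prop))]
    apply intervalIntegral.integral_congr
    intro x _
    simp only [linearTrig, add_mul, Finset.sum_mul, mul_assoc]
  rw [h1, cosCoeff_eq_zero_of_odd (g := fun x => x) (fun x => rfl)]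
  simp only [mul_zero, add_zero]
  congr 1
  refine Finset.sum_congr rfl fun j _ => ?_
  rw [cosCoeff_cos _ _ (by omega), cosCoeff_eq_zero_of_odd (fun x => by rw [mul_neg, Real.sin_neg]),
    mul_zero, add_zero]

lemma cosCoeff_linearTrig_zero (m : ℕ) (c d : ℝ) (p q : ℕ → ℝ) :
    cosCoeff (linearTrig m c d p q) 0 = 2 * Real.pi * c := by
  rw [cosCoeff_linearTrig_expand, cosCoeff_const]
  simp

lemma cosCoeff_linearTrig (m : ℕ) (c d : ℝ) {p : ℕ → ℝ} (q : ℕ → ℝ)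
    (hp : ∀ k, m ≤ k → p k = 0) (k : ℕ) :
    cosCoeff (linearTrig m c d p q) (k + 1) = Real.pi * p k := by
  rw [cosCoeff_linearTrig_expand, cosCoeff_const, if_neg (by omega)]
  simp only [add_left_inj, mul_ite, mul_zero, Finset.sum_ite_eq, Finset.mem_range, zero_add]
  split_ifs with h
  · ring
  · rw [hp k (by omega)]
    ring

lemma sinCoeff_linearTrig (m : ℕ) (c d : ℝ) (p : ℕ → ℝ) {q : ℕ → ℝ}
    (hq : ∀ k, m ≤ k → q k = 0) (k : ℕ) :
    sinCoeff (linearTrig m c d p q) (k + 1) =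
      d * (2 * Real.pi * (-1) ^ k / (k + 1)) + Real.pi * q k := by
  have h1 : sinCoeff (linearTrig m c d p q) (k + 1) = sinCoeff (fun _ => c) (k + 1) +
      d * sinCoeff (fun x => x) (k + 1) + ∑ j ∈ Finset.range m,
        (p j * sinCoeff (fun x => Real.cos (((j + 1 : ℕ) : ℝ) * x)) (k + 1) +
          q j * sinCoeff (fun x => Real.sin (((j + 1 : ℕ) : ℝ) * x)) (k + 1)) := by
    simp only [sinCoeff, ← intervalIntegral.integral_const_mul]
    have hI : ∀ u : ℝ → ℝ, Continuous u → IntervalIntegrable u volume (-Real.pi) Real.pi :=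
      fun u hu => hu.intervalIntegrable _ _
    rw [Finset.sum_congr rfl fun j _ => (intervalIntegral.integral_add (hI _ (by fun_prop))
      (hI _ (by fun_prop))).symm, ← intervalIntegral.integral_finsetSum
      (fun j _ => hI _ (by fun_prop)),
      ← intervalIntegral.integral_add (hI _ (by fun_prop)) (hI _ (by fun_prop)),
      ← intervalIntegral.integral_add (hI _ (by fun_prop)) (hI _ (by fun_prop))]
    apply intervalIntegral.integral_congr
    intro x _
    simp only [linearTrig, add_mul, Finset.sum_mul, mul_assoc]
  rw [h1, sinCoeff_eq_zero_of_even (fun x => rfl), sinCoeff_id]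
  have h2 : ∀ j ∈ Finset.range m,
      (p j * sinCoeff (fun x => Real.cos (((j + 1 : ℕ) : ℝ) * x)) (k + 1) +
        q j * sinCoeff (fun x => Real.sin (((j + 1 : ℕ) : ℝ) * x)) (k + 1)) =
      if k = j then q j * Real.pi else 0 := by
    intro j _
    rw [sinCoeff_sin _ _ (by omega), sinCoeff_eq_zero_of_even
      (fun x => by rw [mul_neg, Real.cos_neg])]
    simp
  rw [Finset.sum_congr rfl h2]
  simp only [Finset.sum_ite_eq, Finset.mem_range]
  split_ifs with h
  · ring
  · rw [hq k (by omega)]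
    ring

/-! ### Fejér weights, their defects and sums against them. -/

/-- The defect `1/k - w_k/k = min (1/(m+1)) (1/k)` of the Fejér weights `w_k`, with `k` shifted
by one. -/
def fejerDefect (m k : ℕ) : ℝ := min (1 / ((m : ℝ) + 1)) (1 / ((k : ℝ) + 1))

/-- The Fejér weight `w_k` divided by `k`, with `k` shifted by one. -/
def fejerWeight (m k : ℕ) : ℝ := 1 / ((k : ℝ) + 1) - fejerDefect m k

lemma fejerDefect_pos (m k : ℕ) : 0 < fejerDefect m k :=
  lt_min (by positivity) (by positivity)

lemma fejerDefect_le (m k : ℕ) : fejerDefect m k ≤ 1 / ((m : ℝ) + 1) := min_le_left _ _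

lemma fejerDefect_of_lt {m k : ℕ} (h : k < m) : fejerDefect m k = 1 / ((m : ℝ) + 1) := by
  have : (k : ℝ) ≤ m := by exact_mod_cast h.le
  exact min_eq_left (by gcongr)

lemma fejerDefect_of_le {m k : ℕ} (h : m ≤ k) : fejerDefect m k = 1 / ((k : ℝ) + 1) := by
  have : (m : ℝ) ≤ k := by exact_mod_cast h
  exact min_eq_right (by gcongr)

lemma fejerWeight_eq_zero {m k : ℕ} (h : m ≤ k) : fejerWeight m k = 0 := by
  rw [fejerWeight, fejerDefect_of_le h, sub_self]

lemma fejerWeight_of_lt {m k : ℕ} (h : k < m) :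
    fejerWeight m k = (1 - ((k : ℝ) + 1) / ((m : ℝ) + 1)) / ((k : ℝ) + 1) := by
  rw [fejerWeight, fejerDefect_of_lt h]
  have h1 : (k : ℝ) + 1 ≠ 0 := by positivity
  have h2 : (m : ℝ) + 1 ≠ 0 := by positivity
  field_simp

/-- A telescoping series, used as the majorant for the squared defects. -/
lemma hasSum_inv_add_sub (m : ℕ) :
    HasSum (fun k : ℕ => 1 / ((m : ℝ) + 1 + k) - 1 / ((m : ℝ) + 1 + (k + 1 : ℕ)))
      (1 / ((m : ℝ) + 1)) := by
  have h : Tendsto (fun k : ℕ => 1 / ((m : ℝ) + 1 + k)) atTop (𝓝 0) := by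
    simp only [one_div]
    exact (tendsto_atTop_add_const_left _ _ tendsto_natCast_atTop_atTop).inv_tendsto_atTop
  rw [hasSum_iff_tendsto_nat_of_nonneg]
  · have h2 := h.const_sub (1 / ((m : ℝ) + 1))
    rw [sub_zero] at h2
    refine h2.congr fun n => ?_
    rw [Finset.sum_range_sub']
    simp
  · intro k
    rw [sub_nonneg]
    gcongr
    omega

/-- The smaller of 1/a and 1/b is at most 2/(a + b); the square of this bound is dominated by a
telescoping difference. -/
lemma fejerDefect_sq_le (m k : ℕ) :
    fejerDefect m k ^ 2 ≤ 4 * (1 / ((m : ℝ) + 1 + k) - 1 / ((m : ℝ) + 1 + (k + 1 : ℕ))) := by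
  have hm : (0 : ℝ) ≤ m := Nat.cast_nonneg m
  have hk : (0 : ℝ) ≤ k := Nat.cast_nonneg k
  have h1 : fejerDefect m k ≤ 2 / ((m : ℝ) + k + 2) := by
    rcases le_total m k with h | h
    · have : (m : ℝ) ≤ k := by exact_mod_cast h
      rw [fejerDefect_of_le h, div_le_div_iff₀ (by positivity) (by positivity)]
      linarith
    · have : (k : ℝ) ≤ m := by exact_mod_cast h
      refine (fejerDefect_le m k).trans ?_
      rw [div_le_div_iff₀ (by positivity) (by positivity)]
      linarith
  calc fejerDefect m k ^ 2 ≤ (2 / ((m : ℝ) + k + 2)) ^ 2 := by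
        gcongr
        exact (fejerDefect_pos m k).le
    _ ≤ 4 * (1 / (((m : ℝ) + 1 + k) * ((m : ℝ) + k + 2))) := by
        rw [div_pow, mul_one_div, show (2 : ℝ) ^ 2 = 4 by norm_num]
        gcongr
        nlinarith
    _ = _ := by
        push_cast
        field_simp
        ring

lemma summable_fejerDefect_sq (m : ℕ) : Summable (fun k => fejerDefect m k ^ 2) :=
  Summable.of_nonneg_of_le (fun _ => sq_nonneg _) (fejerDefect_sq_le m)
    ((hasSum_inv_add_sub m).mul_left 4).summable

lemma tsum_fejerDefect_sq_le (m : ℕ) : ∑' k, fejerDefect m k ^ 2 ≤ 4 / ((m : ℝ) + 1) := by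
  have h := (hasSum_inv_add_sub m).mul_left 4
  rw [← mul_one_div, ← h.tsum_eq]
  exact (summable_fejerDefect_sq m).tsum_le_tsum (fejerDefect_sq_le m) h.summable

lemma summable_inv_succ_sq : Summable (fun k : ℕ => (1 / ((k : ℝ) + 1)) ^ 2) := by
  have h := (summable_nat_add_iff 1).2 hasSum_zeta_two.summable
  refine h.congr fun k => ?_
  push_cast
  rw [div_pow, one_pow]

lemma tsum_inv_succ_sq : ∑' k : ℕ, (1 / ((k : ℝ) + 1)) ^ 2 = Real.pi ^ 2 / 6 := by
  have h := (hasSum_nat_add_iff' 1).2 hasSum_zeta_two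
  simp only [Finset.range_one, Finset.sum_singleton, Nat.cast_zero] at h
  have h2 := h.tsum_eq
  push_cast at h2
  simp only [div_pow, one_pow]
  rw [h2]
  norm_num

lemma summable_fejerDefect_mul {u : ℕ → ℝ} (hu : Summable fun k => |u k|) (m : ℕ) :
    Summable (fun k => fejerDefect m k * u k) := by
  refine Summable.of_norm_bounded (hu.mul_left (1 / ((m : ℝ) + 1))) fun k => ?_
  rw [norm_mul, Real.norm_eq_abs, Real.norm_eq_abs, abs_of_pos (fejerDefect_pos m k)]
  exact mul_le_mul_of_nonneg_right (fejerDefect_le m k) (abs_nonneg _)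

/-- The defect is at most 1/(m+1), so an absolutely summable sequence produces no logarithm. -/
lemma abs_tsum_fejerDefect_mul_le {u : ℕ → ℝ} (hu : Summable fun k => |u k|) (m : ℕ) :
    |∑' k, fejerDefect m k * u k| ≤ (∑' k, |u k|) / ((m : ℝ) + 1) := by
  have h := tsum_of_norm_bounded (hu.hasSum.mul_left (1 / ((m : ℝ) + 1)))
    (f := fun k => fejerDefect m k * u k) fun k => by
      rw [norm_mul, Real.norm_eq_abs, Real.norm_eq_abs, abs_of_pos (fejerDefect_pos m k)]
      exact mul_le_mul_of_nonneg_right (fejerDefect_le m k) (abs_nonneg _)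
  rw [Real.norm_eq_abs] at h
  calc _ ≤ _ := h
    _ = _ := by ring

lemma summable_fejerDefect_div (m : ℕ) :
    Summable (fun k : ℕ => fejerDefect m k * (1 / ((k : ℝ) + 1))) := by
  refine Summable.of_nonneg_of_le (fun k => mul_nonneg (fejerDefect_pos m k).le (by positivity))
    (fun k => ?_) summable_inv_succ_sq
  rw [sq]
  exact mul_le_mul_of_nonneg_right (min_le_right _ _) (by positivity)

/-- The logarithmic sum `∑ min (1/(m+1)) (1/k) / k = log m / m + O(1/m)`. -/
lemma abs_tsum_fejerDefect_div_sub_le {m : ℕ} (hm : 1 ≤ m) :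
    |(∑' k : ℕ, fejerDefect m k * (1 / ((k : ℝ) + 1))) - Real.log m / m| ≤ 5 / m := by
  have hm1 : (1 : ℝ) ≤ m := by exact_mod_cast hm
  have hmpos : (0 : ℝ) < m := by linarith
  have hs := summable_fejerDefect_div m
  have h1 := hs.sum_add_tsum_nat_add m
  -- Below m the defect is constant, so the head is a harmonic number over m + 1; this is the source
  -- of the logarithm.
  have hhead : ∑ k ∈ Finset.range m, fejerDefect m k * (1 / ((k : ℝ) + 1)) =
      (harmonic m : ℝ) / ((m : ℝ) + 1) := by
    rw [harmonic]
    push_cast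
    rw [Finset.sum_div]
    refine Finset.sum_congr rfl fun k hk => ?_
    rw [fejerDefect_of_lt (Finset.mem_range.1 hk)]
    have h1 : (k : ℝ) + 1 ≠ 0 := by positivity
    field_simp
  have htail0 : 0 ≤ ∑' k : ℕ, fejerDefect m (k + m) * (1 / (((k + m : ℕ) : ℝ) + 1)) :=
    tsum_nonneg fun k => mul_nonneg (fejerDefect_pos m _).le (by positivity)
  -- From m on the defect equals 1/(k+1), so the tail is a tail of the series of squared defects.
  have htail : ∑' k : ℕ, fejerDefect m (k + m) * (1 / (((k + m : ℕ) : ℝ) + 1)) ≤ 4 / m := by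
    have e : ∀ k : ℕ, fejerDefect m (k + m) * (1 / (((k + m : ℕ) : ℝ) + 1)) =
        fejerDefect m (k + m) ^ 2 := fun k => by
      rw [sq]
      nth_rw 3 [fejerDefect_of_le (Nat.le_add_left m k)]
    simp only [e]
    have h2 := (summable_fejerDefect_sq m).sum_add_tsum_nat_add m
    have h3 : 0 ≤ ∑ k ∈ Finset.range m, fejerDefect m k ^ 2 :=
      Finset.sum_nonneg fun _ _ => sq_nonneg _
    calc _ ≤ ∑' k, fejerDefect m k ^ 2 := by linarith
      _ ≤ 4 / ((m : ℝ) + 1) := tsum_fejerDefect_sq_le m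
      _ ≤ 4 / m := by gcongr; linarith
  have hup := harmonic_le_one_add_log m
  have hlo := log_add_one_le_harmonic m
  have hlog0 : 0 ≤ Real.log m := Real.log_nonneg hm1
  have hlogm : Real.log m ≤ m := (Real.log_le_sub_one_of_pos hmpos).trans (by linarith)
  have hmono : Real.log m ≤ harmonic m :=
    (Real.log_le_log hmpos (by push_cast; linarith)).trans hlo
  have hu : (harmonic m : ℝ) / ((m : ℝ) + 1) ≤ 1 / m + Real.log m / m := by
    rw [← add_div]
    gcongr
    · linarith
  have hl : Real.log m / m - 1 / m ≤ (harmonic m : ℝ) / ((m : ℝ) + 1) := by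
    calc Real.log m / m - 1 / m ≤ Real.log m / ((m : ℝ) + 1) := by
          rw [← sub_div, div_le_div_iff₀ hmpos (by positivity)]
          nlinarith
      _ ≤ _ := by gcongr
  rw [hhead] at h1
  have e5 : (5 : ℝ) / m = 4 / m + 1 / m := by ring
  rw [abs_le]
  constructor <;> linarith [div_nonneg zero_le_four hmpos.le]

/-! ### Circular distribution functions and the integrated squared bias. -/

lemma cosCoeff_sub {g h : ℝ → ℝ} (hg : SqInt g) (hh : SqInt h) (k : ℕ) :
    cosCoeff (g - h) k = cosCoeff g k - cosCoeff h k := by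
  unfold cosCoeff
  rw [← intervalIntegral.integral_sub (hg.intervalIntegrable.mul_continuousOn (by fun_prop))
    (hh.intervalIntegrable.mul_continuousOn (by fun_prop))]
  simp [sub_mul]

lemma sinCoeff_sub {g h : ℝ → ℝ} (hg : SqInt g) (hh : SqInt h) (k : ℕ) :
    sinCoeff (g - h) k = sinCoeff g k - sinCoeff h k := by
  unfold sinCoeff
  rw [← intervalIntegral.integral_sub (hg.intervalIntegrable.mul_continuousOn (by fun_prop))
    (hh.intervalIntegrable.mul_continuousOn (by fun_prop))]
  simp [sub_mul]

lemma summable_cosCoeff_sq {g : ℝ → ℝ} (hg : SqInt g) :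
    Summable (fun k : ℕ => cosCoeff g (k + 1) ^ 2) :=
  Summable.of_nonneg_of_le (fun _ => sq_nonneg _)
    (fun k => le_add_of_nonneg_right (sq_nonneg (sinCoeff g (k + 1)))) (hasSum_sq_coeff hg).summable

/-- By 2|uv| ≤ u² + v². This turns square summability from Parseval into absolute summability after
one integration by parts. -/
lemma summable_abs_div_succ {u : ℕ → ℝ} (hu : Summable fun k => u k ^ 2) :
    Summable (fun k : ℕ => |u k / ((k : ℝ) + 1)|) := by
  refine Summable.of_nonneg_of_le (fun _ => abs_nonneg _) (fun k => ?_)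
    (hu.add summable_inv_succ_sq)
  rw [div_eq_mul_one_div, abs_mul]
  nlinarith [sq_nonneg (|u k| - |1 / ((k : ℝ) + 1)|), sq_abs (u k), sq_abs (1 / ((k : ℝ) + 1)),
    sq_nonneg (u k), sq_nonneg (1 / ((k : ℝ) + 1))]

/-- The Fejér mean of order `m` of the function `x / 2`. -/
def fejerSawtooth (m : ℕ) (x : ℝ) : ℝ :=
  ∑ k ∈ Finset.range m, fejerWeight m k * (-1) ^ k * Real.sin (((k + 1 : ℕ) : ℝ) * x)

/-- The integral of `K_m (y - x)` over `y ∈ [-π, θ]`, in expanded form. -/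
def fejerCdf (m : ℕ) (θ x : ℝ) : ℝ :=
  linearTrig m (1 / 2 - fejerSawtooth m x / Real.pi) (1 / (2 * Real.pi))
    (fun k => -(fejerWeight m k * Real.sin (((k + 1 : ℕ) : ℝ) * x) / Real.pi))
    (fun k => fejerWeight m k * Real.cos (((k + 1 : ℕ) : ℝ) * x) / Real.pi) θ

/-- The expectation of `fejerCdf m θ X` for `X` of density `f`. -/
def fejerMean (f : ℝ → ℝ) (m : ℕ) : ℝ → ℝ :=
  linearTrig m
    (1 / 2 - (∑ k ∈ Finset.range m, fejerWeight m k * (-1) ^ k * sinCoeff f (k + 1)) / Real.pi)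
    (1 / (2 * Real.pi))
    (fun k => -(fejerWeight m k * sinCoeff f (k + 1) / Real.pi))
    (fun k => fejerWeight m k * cosCoeff f (k + 1) / Real.pi)

/-- `F` is the distribution function on `[-π, π]` of a density `f`, continuous on the circle,
with square integrable derivative `f'`. -/
structure IsCircularCdf (F f f' : ℝ → ℝ) : Prop where
  continuousOn : ContinuousOn F (Icc (-Real.pi) Real.pi)
  hasDerivAt : ∀ x ∈ Ioo (-Real.pi) Real.pi, HasDerivAt F (f x) x
  map_neg_pi : F (-Real.pi) = 0
  map_pi : F Real.pi = 1
  density_continuousOn : ContinuousOn f (Icc (-Real.pi) Real.pi)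
  density_hasDerivAt : ∀ x ∈ Ioo (-Real.pi) Real.pi, HasDerivAt f (f' x) x
  density_periodic : f Real.pi = f (-Real.pi)
  sqInt_deriv : SqInt f'

namespace IsCircularCdf

variable {F f f' : ℝ → ℝ}

lemma sqInt (h : IsCircularCdf F f f') : SqInt F := sqInt_of_continuousOn h.continuousOn

lemma sqInt_density (h : IsCircularCdf F f f') : SqInt f :=
  sqInt_of_continuousOn h.density_continuousOn

lemma intervalIntegrable_density (h : IsCircularCdf F f f') :
    IntervalIntegrable f volume (-Real.pi) Real.pi :=
  h.sqInt_density.intervalIntegrable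

lemma integral_density (h : IsCircularCdf F f f') : ∫ x in (-Real.pi)..Real.pi, f x = 1 := by
  rw [intervalIntegral.integral_eq_sub_of_hasDerivAt_of_le neg_pi_lt_pi.le h.continuousOn
    h.hasDerivAt h.intervalIntegrable_density, h.map_pi, h.map_neg_pi, sub_zero]

/-- The boundary term vanishes because the density takes the same value at both ends; continuity on
the circle thus makes ∑ |b_k| finite. -/
lemma sinCoeff_density (h : IsCircularCdf F f f') (k : ℕ) :
    sinCoeff f (k + 1) = cosCoeff f' (k + 1) / (k + 1) := by
  rw [sinCoeff_eq_of_hasDerivAt h.density_continuousOn h.density_hasDerivAt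
    h.sqInt_deriv.intervalIntegrable, h.density_periodic, sub_self, zero_mul, zero_add]

lemma summable_abs_sinCoeff (h : IsCircularCdf F f f') :
    Summable (fun k : ℕ => |sinCoeff f (k + 1)|) := by
  simp only [h.sinCoeff_density]
  exact summable_abs_div_succ (summable_cosCoeff_sq h.sqInt_deriv)

lemma summable_abs_signed_sinCoeff (h : IsCircularCdf F f f') :
    Summable (fun k : ℕ => |(-1) ^ k * sinCoeff f (k + 1)|) := by
  simpa [abs_mul] using h.summable_abs_sinCoeff

lemma summable_abs_signed_cosCoeff_div (h : IsCircularCdf F f f') :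
    Summable (fun k : ℕ => |(-1) ^ k * cosCoeff f (k + 1) / ((k : ℝ) + 1)|) := by
  have := summable_abs_div_succ (summable_cosCoeff_sq h.sqInt_density)
  simpa [abs_mul, abs_div] using this

/-- Bilinear Parseval against x, which is odd, so only its sine coefficients survive. -/
lemma hasSum_integral_id_mul (h : IsCircularCdf F f f') :
    HasSum (fun k : ℕ => 2 * (-1) ^ k * sinCoeff f (k + 1) / ((k : ℝ) + 1))
      (∫ x in (-Real.pi)..Real.pi, x * f x) := by
  have hp := (hasSum_mul_coeff (g := fun x => x) (sqInt_of_continuousOn (by fun_prop))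
    h.sqInt_density).div_const Real.pi
  have hz : ∀ k, cosCoeff (fun x : ℝ => x) k = 0 :=
    cosCoeff_eq_zero_of_odd (g := fun x : ℝ => x) (fun x => rfl)
  simp only [hz, sinCoeff_id, zero_mul, zero_add, zero_div, sub_zero] at hp
  have hpi := Real.pi_ne_zero
  rw [mul_div_cancel_left₀ _ hpi] at hp
  convert! hp using 1
  funext k
  field_simp

lemma hasSum_integral_sq_mul (h : IsCircularCdf F f f') :
    HasSum (fun k : ℕ => -4 * ((-1) ^ k * cosCoeff f (k + 1) / ((k : ℝ) + 1) ^ 2))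
      ((∫ x in (-Real.pi)..Real.pi, x ^ 2 * f x) - Real.pi ^ 2 / 3) := by
  have hp := (hasSum_mul_coeff (g := fun x => x ^ 2) (sqInt_of_continuousOn (by fun_prop))
    h.sqInt_density).div_const Real.pi
  have hz : ∀ k, sinCoeff (fun x : ℝ => x ^ 2) k = 0 :=
    sinCoeff_eq_zero_of_even (fun x => by ring)
  have h0 : cosCoeff (fun x : ℝ => x ^ 2) 0 = 2 * Real.pi ^ 3 / 3 := by
    rw [cosCoeff_zero, integral_pow]
    norm_num
    ring
  simp only [hz, cosCoeff_sq, zero_mul, add_zero, h0, cosCoeff_zero f, h.integral_density] at hp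
  have hpi := Real.pi_ne_zero
  convert! hp using 1
  · funext k
    field_simp
  · field_simp

lemma integral_eq (h : IsCircularCdf F f f') :
    ∫ x in (-Real.pi)..Real.pi, F x = Real.pi - ∫ x in (-Real.pi)..Real.pi, x * f x := by
  have hi := intervalIntegral.integral_deriv_mul_eq_sub_of_hasDerivAt
    (a := -Real.pi) (b := Real.pi) (u := fun x => x) (u' := fun _ => 1) (v := F) (v' := f)
    (by fun_prop) (by rw [uIcc_of_le neg_pi_lt_pi.le]; exact h.continuousOn)
    (fun x _ => hasDerivAt_id x)
    (by rw [min_eq_left neg_pi_lt_pi.le, max_eq_right neg_pi_lt_pi.le]; exact h.hasDerivAt)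
    (by simp) h.intervalIntegrable_density
  rw [intervalIntegral.integral_add (by simpa using h.sqInt.intervalIntegrable)
    (h.intervalIntegrable_density.continuousOn_mul (by fun_prop)), h.map_pi, h.map_neg_pi] at hi
  simp only [one_mul, mul_one, mul_zero, sub_zero] at hi
  linarith

lemma sqInt_mean (f : ℝ → ℝ) (m : ℕ) : SqInt (fejerMean f m) :=
  sqInt_of_continuousOn (continuous_linearTrig _ _ _ _ _).continuousOn

/-- Both constant coefficients are series in b_k, with weights 1/k for F and 1/k - d_k for the mean;
their difference keeps only d_k. -/
lemma cosCoeff_bias_zero (h : IsCircularCdf F f f') (m : ℕ) :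
    cosCoeff (fejerMean f m - F) 0 =
      2 * ∑' k : ℕ, fejerDefect m k * ((-1) ^ k * sinCoeff f (k + 1)) := by
  rw [cosCoeff_sub (sqInt_mean f m) h.sqInt, fejerMean, cosCoeff_linearTrig_zero, cosCoeff_zero,
    h.integral_eq]
  have h1 := h.hasSum_integral_id_mul
  have h2 : HasSum (fun k : ℕ => 2 * (fejerWeight m k * (-1) ^ k * sinCoeff f (k + 1)))
      (∑ k ∈ Finset.range m, 2 * (fejerWeight m k * (-1) ^ k * sinCoeff f (k + 1))) := by
    apply hasSum_sum_of_ne_finset_zero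
    intro k hk
    rw [fejerWeight_eq_zero (by simpa using hk)]
    ring
  have h3 := (h1.sub h2).tsum_eq
  rw [← tsum_mul_left]
  have e : ∀ k : ℕ, 2 * (fejerDefect m k * ((-1) ^ k * sinCoeff f (k + 1))) =
      2 * (-1) ^ k * sinCoeff f (k + 1) / ((k : ℝ) + 1) -
        2 * (fejerWeight m k * (-1) ^ k * sinCoeff f (k + 1)) := by
    intro k
    rw [fejerWeight]
    ring
  simp only [e, h3]
  rw [← Finset.mul_sum]
  have hpi := Real.pi_ne_zero
  field_simp
  ring

lemma cosCoeff_bias (h : IsCircularCdf F f f') (m k : ℕ) :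
    cosCoeff (fejerMean f m - F) (k + 1) = fejerDefect m k * sinCoeff f (k + 1) := by
  rw [cosCoeff_sub (sqInt_mean f m) h.sqInt, fejerMean,
    cosCoeff_linearTrig _ _ _ _ (fun k hk => by rw [fejerWeight_eq_zero hk]; ring),
    cosCoeff_eq_of_hasDerivAt h.continuousOn h.hasDerivAt h.intervalIntegrable_density,
    fejerWeight]
  have hpi := Real.pi_ne_zero
  field_simp
  ring

/-- The jump F(π) - F(-π) = 1 gives F the coefficients of θ/(2π), which the linear part of the mean
reproduces exactly; only the defect remains. -/
lemma sinCoeff_bias (h : IsCircularCdf F f f') (m k : ℕ) :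
    sinCoeff (fejerMean f m - F) (k + 1) = -(fejerDefect m k * cosCoeff f (k + 1)) := by
  rw [sinCoeff_sub (sqInt_mean f m) h.sqInt, fejerMean,
    sinCoeff_linearTrig _ _ _ _ (fun k hk => by rw [fejerWeight_eq_zero hk]; ring),
    sinCoeff_eq_of_hasDerivAt h.continuousOn h.hasDerivAt h.intervalIntegrable_density,
    fejerWeight, h.map_pi, h.map_neg_pi]
  have hpi := Real.pi_ne_zero
  field_simp
  ring

/-- The integrated squared bias of the Fejér estimator. -/
lemma integral_bias_sq (h : IsCircularCdf F f f') (m : ℕ) :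
    ∫ x in (-Real.pi)..Real.pi, (fejerMean f m x - F x) ^ 2 =
      1 / Real.pi *
        (∑' k : ℕ, fejerDefect m k ^ 2 * (cosCoeff f (k + 1) ^ 2 + sinCoeff f (k + 1) ^ 2)) +
      2 / Real.pi * (∑' k : ℕ, fejerDefect m k * ((-1) ^ k * sinCoeff f (k + 1))) ^ 2 := by
  have hp := (hasSum_sq_coeff ((sqInt_mean f m).sub h.sqInt)).tsum_eq
  simp only [h.cosCoeff_bias_zero, h.cosCoeff_bias, h.sinCoeff_bias, Pi.sub_apply] at hp
  have e : ∀ k : ℕ, (fejerDefect m k * sinCoeff f (k + 1)) ^ 2 +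
      (-(fejerDefect m k * cosCoeff f (k + 1))) ^ 2 =
      fejerDefect m k ^ 2 * (cosCoeff f (k + 1) ^ 2 + sinCoeff f (k + 1) ^ 2) := fun k => by ring
  simp only [e] at hp
  rw [hp]
  have hpi := Real.pi_ne_zero
  field_simp
  ring

/-- The limit of `(m + 1)²` times the integrated squared bias. -/
lemma tendsto_integral_bias_sq (h : IsCircularCdf F f f') :
    Tendsto (fun m : ℕ => ((m : ℝ) + 1) ^ 2 *
        ∫ x in (-Real.pi)..Real.pi, (fejerMean f m x - F x) ^ 2) atTop
      (𝓝 (1 / Real.pi * (∑' k : ℕ, (cosCoeff f (k + 1) ^ 2 + sinCoeff f (k + 1) ^ 2)) +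
        2 / Real.pi * (∑' k : ℕ, (-1) ^ k * sinCoeff f (k + 1)) ^ 2)) := by
  have hle : ∀ m k : ℕ, ((m : ℝ) + 1) * fejerDefect m k ≤ 1 := fun m k => by
    have := fejerDefect_le m k
    rw [le_div_iff₀ (by positivity)] at this
    linarith
  have hnn : ∀ m k : ℕ, 0 ≤ ((m : ℝ) + 1) * fejerDefect m k := fun m k =>
    mul_nonneg (by positivity) (fejerDefect_pos m k).le
  -- For fixed k the rescaled defect is exactly 1 once m exceeds k; with the bound 1 this allows
  -- dominated convergence in both series.
  have hlim : ∀ k : ℕ, ∀ᶠ m : ℕ in atTop, ((m : ℝ) + 1) * fejerDefect m k = 1 := fun k => by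
    filter_upwards [eventually_gt_atTop k] with m hm
    rw [fejerDefect_of_lt hm, mul_one_div, div_self (by positivity)]
  have t1 : Tendsto (fun m : ℕ => ∑' k : ℕ, (((m : ℝ) + 1) * fejerDefect m k) ^ 2 *
      (cosCoeff f (k + 1) ^ 2 + sinCoeff f (k + 1) ^ 2)) atTop
      (𝓝 (∑' k : ℕ, (cosCoeff f (k + 1) ^ 2 + sinCoeff f (k + 1) ^ 2))) := by
    refine tendsto_tsum_of_dominated_convergence (hasSum_sq_coeff h.sqInt_density).summable
      (fun k => ?_) (Eventually.of_forall fun m k => ?_)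
    · refine tendsto_const_nhds.congr' ?_
      filter_upwards [hlim k] with m hm
      rw [hm]
      ring
    · have hsq : (((m : ℝ) + 1) * fejerDefect m k) ^ 2 ≤ 1 := pow_le_one₀ (hnn m k) (hle m k)
      rw [Real.norm_eq_abs, abs_of_nonneg (by positivity)]
      exact mul_le_of_le_one_left (by positivity) hsq
  have t2 : Tendsto (fun m : ℕ => ∑' k : ℕ, (((m : ℝ) + 1) * fejerDefect m k) *
      ((-1) ^ k * sinCoeff f (k + 1))) atTop (𝓝 (∑' k : ℕ, (-1) ^ k * sinCoeff f (k + 1))) := by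
    refine tendsto_tsum_of_dominated_convergence h.summable_abs_signed_sinCoeff
      (fun k => ?_) (Eventually.of_forall fun m k => ?_)
    · refine tendsto_const_nhds.congr' ?_
      filter_upwards [hlim k] with m hm
      rw [hm, one_mul]
    · rw [Real.norm_eq_abs, abs_mul, abs_of_nonneg (hnn m k)]
      exact mul_le_of_le_one_left (abs_nonneg _) (hle m k)
  refine ((t1.const_mul (1 / Real.pi)).add ((t2.pow 2).const_mul (2 / Real.pi))).congr fun m => ?_
  simp only [h.integral_bias_sq, mul_assoc, tsum_mul_left, mul_pow]
  ring

/-- The integrated squared bias is of order `1 / m²`. -/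
lemma exists_integral_bias_sq_le (h : IsCircularCdf F f f') :
    ∃ C, 0 ≤ C ∧ ∀ m : ℕ,
      ∫ x in (-Real.pi)..Real.pi, (fejerMean f m x - F x) ^ 2 ≤ (C / ((m : ℝ) + 1)) ^ 2 := by
  obtain ⟨C, hC⟩ := h.tendsto_integral_bias_sq.bddAbove_range
  refine ⟨√C, Real.sqrt_nonneg _, fun m => ?_⟩
  have hm : (0 : ℝ) < (m : ℝ) + 1 := by positivity
  have h1 : ((m : ℝ) + 1) ^ 2 * (∫ x in (-Real.pi)..Real.pi, (fejerMean f m x - F x) ^ 2) ≤ C :=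
    hC ⟨m, rfl⟩
  have h0 : 0 ≤ ∫ x in (-Real.pi)..Real.pi, (fejerMean f m x - F x) ^ 2 :=
    intervalIntegral.integral_nonneg neg_pi_lt_pi.le fun _ _ => sq_nonneg _
  rw [div_pow, Real.sq_sqrt ((mul_nonneg (by positivity) h0).trans h1), le_div_iff₀ (by positivity)]
  linarith

end IsCircularCdf

/-! ### The second moment of a single contribution, integrated over θ. -/

lemma continuous_fejerSawtooth (m : ℕ) : Continuous (fejerSawtooth m) := by
  unfold fejerSawtooth
  fun_prop

lemma fejerCdf_eq (m : ℕ) (θ x : ℝ) :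
    fejerCdf m θ x = 1 / 2 - fejerSawtooth m x / Real.pi + θ / (2 * Real.pi) +
      (∑ k ∈ Finset.range m, fejerWeight m k * Real.sin (((k + 1 : ℕ) : ℝ) * (θ - x))) /
        Real.pi := by
  rw [fejerCdf, linearTrig, Finset.sum_div]
  congr 1
  · ring
  · refine Finset.sum_congr rfl fun k _ => ?_
    rw [mul_sub, Real.sin_sub]
    ring

/-- The integral of `fejerCdf m θ x ^ 2` over `θ`. -/
def fejerCdfSqIntegral (m : ℕ) (x : ℝ) : ℝ :=
  2 * Real.pi * (1 / 2 - fejerSawtooth m x / Real.pi) ^ 2 +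
    (Real.pi ^ 2 / 3 - 2 * (∑' k : ℕ, fejerDefect m k * (1 / ((k : ℝ) + 1))) +
      ∑' k : ℕ, fejerDefect m k ^ 2) / Real.pi +
    2 / Real.pi * ∑ k ∈ Finset.range m,
      fejerWeight m k * (-1) ^ k / ((k : ℝ) + 1) * Real.cos (((k + 1 : ℕ) : ℝ) * x)

/-- Parseval in θ with x fixed. The squared weights lose their dependence on x by sin² + cos² = 1,
while the cross terms with the linear part leave the cosine sum. -/
lemma integral_fejerCdf_sq (m : ℕ) (x : ℝ) :
    ∫ θ in (-Real.pi)..Real.pi, fejerCdf m θ x ^ 2 = fejerCdfSqIntegral m x := by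
  have hpi := Real.pi_ne_zero
  have hp := hasSum_sq_coeff (g := fun θ => fejerCdf m θ x) (sqInt_of_continuousOn
    (continuous_linearTrig _ _ _ _ _).continuousOn)
  have hc0 : cosCoeff (fun θ => fejerCdf m θ x) 0 =
    2 * Real.pi * (1 / 2 - fejerSawtooth m x / Real.pi) := cosCoeff_linearTrig_zero _ _ _ _ _
  have hc : ∀ k : ℕ, cosCoeff (fun θ => fejerCdf m θ x) (k + 1) =
      -(fejerWeight m k * Real.sin (((k + 1 : ℕ) : ℝ) * x)) := fun k => by
    refine (cosCoeff_linearTrig _ _ _ _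
      (fun k hk => by rw [fejerWeight_eq_zero hk]; ring) k).trans ?_
    field_simp
  have hs : ∀ k : ℕ, sinCoeff (fun θ => fejerCdf m θ x) (k + 1) =
      (-1) ^ k / (k + 1) + fejerWeight m k * Real.cos (((k + 1 : ℕ) : ℝ) * x) := fun k => by
    refine (sinCoeff_linearTrig _ _ _ _
      (fun k hk => by rw [fejerWeight_eq_zero hk]; ring) k).trans ?_
    field_simp
  -- One 1/k² comes from the linear part and one from (1/k - d_k)², which also yields -2 d_k/k +
  -- d_k².
  have h1 := ((summable_inv_succ_sq.hasSum.mul_left 2).sub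
    ((summable_fejerDefect_div m).hasSum.mul_left 2)).add (summable_fejerDefect_sq m).hasSum
  have h2 : HasSum (fun k : ℕ => 2 * (fejerWeight m k * (-1) ^ k / ((k : ℝ) + 1) *
        Real.cos (((k + 1 : ℕ) : ℝ) * x)))
      (∑ k ∈ Finset.range m, 2 * (fejerWeight m k * (-1) ^ k / ((k : ℝ) + 1) *
        Real.cos (((k + 1 : ℕ) : ℝ) * x))) := by
    apply hasSum_sum_of_ne_finset_zero
    intro k hk
    rw [fejerWeight_eq_zero (by simpa using hk)]
    ring
  have h3 := h1.add h2
  have e : ∀ k : ℕ, cosCoeff (fun θ => fejerCdf m θ x) (k + 1) ^ 2 +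
      sinCoeff (fun θ => fejerCdf m θ x) (k + 1) ^ 2 =
      2 * (1 / ((k : ℝ) + 1)) ^ 2 - 2 * (fejerDefect m k * (1 / ((k : ℝ) + 1))) +
        fejerDefect m k ^ 2 + 2 * (fejerWeight m k * (-1) ^ k / ((k : ℝ) + 1) *
        Real.cos (((k + 1 : ℕ) : ℝ) * x)) := fun k => by
    have hsq : ((-1 : ℝ) ^ k) ^ 2 = 1 := by rw [← pow_mul, mul_comm, pow_mul]; norm_num
    have hw : fejerWeight m k ^ 2 = (1 / ((k : ℝ) + 1)) ^ 2 -
        2 * (fejerDefect m k * (1 / ((k : ℝ) + 1))) + fejerDefect m k ^ 2 := by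
      rw [fejerWeight]
      ring
    rw [hc, hs]
    linear_combination (fejerWeight m k ^ 2) * Real.sin_sq_add_cos_sq (((k + 1 : ℕ) : ℝ) * x) +
      hw + (1 / ((k : ℝ) + 1)) ^ 2 * hsq
  simp only [e] at hp
  have h4 := hp.unique h3
  rw [hc0, tsum_inv_succ_sq, ← Finset.mul_sum] at h4
  rw [fejerCdfSqIntegral]
  generalize (∑ k ∈ Finset.range m, fejerWeight m k * (-1) ^ k / ((k : ℝ) + 1) *
    Real.cos (((k + 1 : ℕ) : ℝ) * x)) = T at h4 ⊢
  field_simp at h4 ⊢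
  linear_combination h4 / 2

/-! ### The sawtooth error. -/

/-- The error of the Fejér mean of `x / 2`. -/
def sawtoothError (m : ℕ) (x : ℝ) : ℝ := fejerSawtooth m x - x / 2

lemma sawtoothError_eq_linearTrig (m : ℕ) :
    sawtoothError m = linearTrig m 0 (-1 / 2) (fun _ => 0) (fun k => fejerWeight m k * (-1) ^ k) := by
  funext x
  simp only [sawtoothError, fejerSawtooth, linearTrig, zero_mul, zero_add]
  ring

lemma continuous_sawtoothError (m : ℕ) : Continuous (sawtoothError m) := by
  rw [sawtoothError_eq_linearTrig]
  exact continuous_linearTrig _ _ _ _ _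

lemma sqInt_sawtoothError (m : ℕ) : SqInt (sawtoothError m) :=
  sqInt_of_continuousOn (continuous_sawtoothError m).continuousOn

lemma cosCoeff_sawtoothError (m k : ℕ) : cosCoeff (sawtoothError m) k = 0 := by
  rw [sawtoothError_eq_linearTrig]
  cases k with
  | zero => rw [cosCoeff_linearTrig_zero, mul_zero]
  | succ k => rw [cosCoeff_linearTrig _ _ _ _ (fun _ _ => rfl), mul_zero]

lemma sinCoeff_sawtoothError (m k : ℕ) :
    sinCoeff (sawtoothError m) (k + 1) = -(Real.pi * (fejerDefect m k * (-1) ^ k)) := by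
  rw [sawtoothError_eq_linearTrig, sinCoeff_linearTrig _ _ _ _
    (fun k hk => by rw [fejerWeight_eq_zero hk, zero_mul]), fejerWeight]
  ring

/-- Bilinear Parseval: the sawtooth error has no cosine part, and its sine coefficients are signed
multiples of the defect. -/
lemma integral_mul_sawtoothError {g : ℝ → ℝ} (hg : SqInt g) (m : ℕ) :
    ∫ x in (-Real.pi)..Real.pi, g x * sawtoothError m x =
      -∑' k : ℕ, fejerDefect m k * ((-1) ^ k * sinCoeff g (k + 1)) := by
  have hp := (hasSum_mul_coeff hg (sqInt_sawtoothError m)).tsum_eq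
  simp only [cosCoeff_sawtoothError, sinCoeff_sawtoothError, mul_zero, zero_add, zero_div,
    sub_zero] at hp
  have e : ∀ k : ℕ, sinCoeff g (k + 1) * -(Real.pi * (fejerDefect m k * (-1) ^ k)) =
      -Real.pi * (fejerDefect m k * ((-1) ^ k * sinCoeff g (k + 1))) := fun k => by ring
  simp only [e, tsum_mul_left] at hp
  apply mul_left_cancel₀ Real.pi_ne_zero
  linarith

lemma integral_sawtoothError_sq_le (m : ℕ) :
    ∫ x in (-Real.pi)..Real.pi, sawtoothError m x ^ 2 ≤ 4 * Real.pi / ((m : ℝ) + 1) := by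
  have hp := (hasSum_sq_coeff (sqInt_sawtoothError m)).tsum_eq
  have hsq : ∀ k : ℕ, ((-1 : ℝ) ^ k) ^ 2 = 1 := fun k => by
    rw [← pow_mul, mul_comm, pow_mul]; norm_num
  simp only [cosCoeff_sawtoothError, sinCoeff_sawtoothError, neg_sq, mul_pow, hsq, mul_one,
    ne_eq, OfNat.ofNat_ne_zero, not_false_eq_true, zero_pow, zero_add, zero_div, sub_zero,
    tsum_mul_left] at hp
  have h1 := tsum_fejerDefect_sq_le m
  have h2 : ∫ x in (-Real.pi)..Real.pi, sawtoothError m x ^ 2 =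
      Real.pi * ∑' k, fejerDefect m k ^ 2 := by
    apply mul_left_cancel₀ Real.pi_ne_zero
    linarith
  rw [h2]
  calc _ ≤ Real.pi * (4 / ((m : ℝ) + 1)) := by gcongr
    _ = _ := by ring

/-! ### Expectations under the density and the variance expansion. -/

namespace IsCircularCdf

variable {F f f' : ℝ → ℝ}

lemma intervalIntegrable_mul (h : IsCircularCdf F f f') {u : ℝ → ℝ} (hu : Continuous u) :
    IntervalIntegrable (fun x => f x * u x) volume (-Real.pi) Real.pi :=
  h.intervalIntegrable_density.mul_continuousOn hu.continuousOn

lemma integral_mul_fejerSawtooth (h : IsCircularCdf F f f') (m : ℕ) :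
    ∫ x in (-Real.pi)..Real.pi, f x * fejerSawtooth m x =
      ∑ k ∈ Finset.range m, fejerWeight m k * (-1) ^ k * sinCoeff f (k + 1) := by
  simp only [sinCoeff, ← intervalIntegral.integral_const_mul]
  rw [← intervalIntegral.integral_finsetSum
    (fun k _ => (h.intervalIntegrable_mul (by fun_prop)).const_mul _)]
  apply intervalIntegral.integral_congr
  intro x _
  simp only [fejerSawtooth, Finset.mul_sum]
  exact Finset.sum_congr rfl fun k _ => by ring

lemma integral_mul_fejerCdf (h : IsCircularCdf F f f') (m : ℕ) (θ : ℝ) :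
    ∫ x in (-Real.pi)..Real.pi, f x * fejerCdf m θ x = fejerMean f m θ := by
  have hS := continuous_fejerSawtooth m
  have e : ∀ x, f x * fejerCdf m θ x = f x * (1 / 2 + θ / (2 * Real.pi)) -
      f x * fejerSawtooth m x / Real.pi + ∑ k ∈ Finset.range m,
        (fejerWeight m k * Real.sin (((k + 1 : ℕ) : ℝ) * θ) / Real.pi *
            (f x * Real.cos (((k + 1 : ℕ) : ℝ) * x)) -
          fejerWeight m k * Real.cos (((k + 1 : ℕ) : ℝ) * θ) / Real.pi *
            (f x * Real.sin (((k + 1 : ℕ) : ℝ) * x))) := fun x => by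
    rw [fejerCdf_eq, Finset.sum_div, mul_add, Finset.mul_sum]
    congr 1
    · ring
    · refine Finset.sum_congr rfl fun k _ => ?_
      rw [mul_sub, Real.sin_sub]
      ring
  have hI : ∀ k, IntervalIntegrable (fun x => fejerWeight m k *
      Real.sin (((k + 1 : ℕ) : ℝ) * θ) / Real.pi * (f x * Real.cos (((k + 1 : ℕ) : ℝ) * x)) -
          fejerWeight m k * Real.cos (((k + 1 : ℕ) : ℝ) * θ) / Real.pi *
            (f x * Real.sin (((k + 1 : ℕ) : ℝ) * x))) volume (-Real.pi) Real.pi := fun k =>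
    ((h.intervalIntegrable_mul (by fun_prop)).const_mul _).sub
      ((h.intervalIntegrable_mul (by fun_prop)).const_mul _)
  have hI1 := h.intervalIntegrable_density.mul_const (1 / 2 + θ / (2 * Real.pi))
  have hI2 := (h.intervalIntegrable_mul hS).div_const Real.pi
  simp only [e]
  rw [intervalIntegral.integral_add (hI1.sub hI2)
    (by simpa only [Finset.sum_fn] using IntervalIntegrable.sum (Finset.range m) fun k _ => hI k),
    intervalIntegral.integral_sub hI1 hI2, intervalIntegral.integral_mul_const,
    intervalIntegral.integral_div, h.integral_mul_fejerSawtooth, h.integral_density,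
    intervalIntegral.integral_finsetSum fun k _ => hI k, fejerMean, linearTrig]
  congr 1
  · ring
  · refine Finset.sum_congr rfl fun k _ => ?_
    rw [intervalIntegral.integral_sub ((h.intervalIntegrable_mul (by fun_prop)).const_mul _)
      ((h.intervalIntegrable_mul (by fun_prop)).const_mul _), intervalIntegral.integral_const_mul,
      intervalIntegral.integral_const_mul, cosCoeff, sinCoeff]
    ring

/-- Write the Fejér mean as x/2 plus its error and expand the square. The integrals of x f and the
multiples of π cancel against ∫ F = π - ∫ x f; the x² f term and the cosine sum differ only by the
defect. -/
lemma integral_mul_fejerCdfSqIntegral (h : IsCircularCdf F f f') (m : ℕ) :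
    (∫ x in (-Real.pi)..Real.pi, f x * fejerCdfSqIntegral m x) -
        ∫ x in (-Real.pi)..Real.pi, F x =
      -(2 / Real.pi) * (∑' k : ℕ, fejerDefect m k * (1 / ((k : ℝ) + 1))) +
      (∑' k : ℕ, fejerDefect m k ^ 2) / Real.pi -
      2 / Real.pi * (∑' k : ℕ, fejerDefect m k * ((-1) ^ k * cosCoeff f (k + 1) / ((k : ℝ) + 1))) -
      2 * (∫ x in (-Real.pi)..Real.pi, f x * sawtoothError m x) +
      2 / Real.pi * (∫ x in (-Real.pi)..Real.pi, x * f x * sawtoothError m x) +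
      2 / Real.pi * ∫ x in (-Real.pi)..Real.pi, f x * sawtoothError m x ^ 2 := by
  have hpi := Real.pi_ne_zero
  have hE := continuous_sawtoothError m
  set K := (Real.pi ^ 2 / 3 - 2 * (∑' k : ℕ, fejerDefect m k * (1 / ((k : ℝ) + 1))) +
      ∑' k : ℕ, fejerDefect m k ^ 2) / Real.pi with hK
  have e : ∀ x, f x * fejerCdfSqIntegral m x =
      (Real.pi / 2 + K) * f x - x * f x + 1 / (2 * Real.pi) * (x ^ 2 * f x) -
      2 * (f x * sawtoothError m x) + 2 / Real.pi * (x * f x * sawtoothError m x) +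
      2 / Real.pi * (f x * sawtoothError m x ^ 2) +
      2 / Real.pi * ∑ k ∈ Finset.range m, fejerWeight m k * (-1) ^ k / ((k : ℝ) + 1) *
        (f x * Real.cos (((k + 1 : ℕ) : ℝ) * x)) := fun x => by
    have es : ∑ k ∈ Finset.range m, fejerWeight m k * (-1) ^ k / ((k : ℝ) + 1) *
        (f x * Real.cos (((k + 1 : ℕ) : ℝ) * x)) =
        f x * ∑ k ∈ Finset.range m, fejerWeight m k * (-1) ^ k / ((k : ℝ) + 1) *
          Real.cos (((k + 1 : ℕ) : ℝ) * x) := by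
      rw [Finset.mul_sum]
      exact Finset.sum_congr rfl fun k _ => by ring
    rw [es, fejerCdfSqIntegral, ← hK, show fejerSawtooth m x = sawtoothError m x + x / 2 by
      rw [sawtoothError]; ring]
    field_simp
    ring
  have i1 := h.intervalIntegrable_density.const_mul (Real.pi / 2 + K)
  have i2 : IntervalIntegrable (fun x => x * f x) volume (-Real.pi) Real.pi :=
    h.intervalIntegrable_density.continuousOn_mul (by fun_prop)
  have i3 : IntervalIntegrable (fun x => 1 / (2 * Real.pi) * (x ^ 2 * f x)) volume
      (-Real.pi) Real.pi :=
    (h.intervalIntegrable_density.continuousOn_mul (by fun_prop)).const_mul _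
  have i4 := (h.intervalIntegrable_mul hE).const_mul 2
  have i5 := (i2.mul_continuousOn hE.continuousOn).const_mul (2 / Real.pi)
  have i6 := (h.intervalIntegrable_mul (u := fun x => sawtoothError m x ^ 2)
    (hE.pow 2)).const_mul (2 / Real.pi)
  have i7 : ∀ k, IntervalIntegrable (fun x => fejerWeight m k * (-1) ^ k / ((k : ℝ) + 1) *
        (f x * Real.cos (((k + 1 : ℕ) : ℝ) * x))) volume (-Real.pi) Real.pi := fun k =>
    (h.intervalIntegrable_mul (by fun_prop)).const_mul _
  have i8 : IntervalIntegrable (fun x => 2 / Real.pi * ∑ k ∈ Finset.range m,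
      fejerWeight m k * (-1) ^ k / ((k : ℝ) + 1) *
        (f x * Real.cos (((k + 1 : ℕ) : ℝ) * x))) volume (-Real.pi) Real.pi :=
    (by simpa only [Finset.sum_fn] using
      IntervalIntegrable.sum (Finset.range m) fun k _ => i7 k : IntervalIntegrable _ _ _ _).const_mul _
  simp only [e]
  rw [intervalIntegral.integral_add (((((i1.sub i2).add i3).sub i4).add i5).add i6) i8,
    intervalIntegral.integral_add ((((i1.sub i2).add i3).sub i4).add i5) i6,
    intervalIntegral.integral_add (((i1.sub i2).add i3).sub i4) i5,
    intervalIntegral.integral_sub ((i1.sub i2).add i3) i4,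
    intervalIntegral.integral_add (i1.sub i2) i3, intervalIntegral.integral_sub i1 i2]
  simp only [intervalIntegral.integral_const_mul]
  rw [intervalIntegral.integral_finsetSum fun k _ => i7 k, h.integral_density, h.integral_eq]
  simp only [intervalIntegral.integral_const_mul]
  have h1 := h.hasSum_integral_sq_mul
  have h2 : HasSum (fun k : ℕ => 4 * (fejerWeight m k * (-1) ^ k / ((k : ℝ) + 1) *
      cosCoeff f (k + 1))) (∑ k ∈ Finset.range m, 4 * (fejerWeight m k * (-1) ^ k / ((k : ℝ) + 1) *
      cosCoeff f (k + 1))) := by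
    apply hasSum_sum_of_ne_finset_zero
    intro k hk
    rw [fejerWeight_eq_zero (by simpa using hk)]
    ring
  have h3 := (h1.add h2).tsum_eq
  -- The x² moment carries 1/k where the cosine sum carries 1/k - d_k, with opposite signs.
  have e3 : ∀ k : ℕ, -4 * ((-1) ^ k * cosCoeff f (k + 1) / ((k : ℝ) + 1) ^ 2) +
      4 * (fejerWeight m k * (-1) ^ k / ((k : ℝ) + 1) * cosCoeff f (k + 1)) =
      -4 * (fejerDefect m k * ((-1) ^ k * cosCoeff f (k + 1) / ((k : ℝ) + 1))) := fun k => by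
    rw [fejerWeight]
    field_simp
    ring
  rw [tsum_congr e3, tsum_mul_left, ← Finset.mul_sum] at h3
  simp only [cosCoeff] at h3
  simp only [cosCoeff, hK]
  field_simp at h3 ⊢
  linear_combination (-1) * h3

end IsCircularCdf

namespace IsCircularCdf

variable {F f f' : ℝ → ℝ}

lemma sqInt_id_mul_deriv (h : IsCircularCdf F f f') : SqInt (fun x => f x + x * f' x) := by
  refine h.sqInt_density.add (MemLp.of_le_mul (c := Real.pi) h.sqInt_deriv ?_ ?_)
  · exact (by fun_prop : Continuous fun x : ℝ => x).aestronglyMeasurable.mul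
      h.sqInt_deriv.aestronglyMeasurable
  · filter_upwards [ae_restrict_mem measurableSet_Ioc] with x hx
    rw [norm_mul]
    gcongr
    rw [Real.norm_eq_abs, abs_le]
    exact ⟨hx.1.le, hx.2⟩

/-- Even for f continuous on the circle, x f(x) jumps by 2π f(-π) at the cut. The boundary term
decays only like 1/k and is the origin of F'(-π) in the expansion. -/
lemma sinCoeff_id_mul (h : IsCircularCdf F f f') (k : ℕ) :
    sinCoeff (fun x => x * f x) (k + 1) = (2 * Real.pi * f (-Real.pi) * (-1) ^ k +
      cosCoeff (fun x => f x + x * f' x) (k + 1)) / (k + 1) := by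
  rw [sinCoeff_eq_of_hasDerivAt (g' := fun x => f x + x * f' x)
    (by exact continuousOn_id.mul h.density_continuousOn)
    (fun x hx => ((hasDerivAt_id' x).fun_mul (h.density_hasDerivAt x hx)).congr_deriv (by ring))
    h.sqInt_id_mul_deriv.intervalIntegrable, h.density_periodic]
  ring

/-- The expansion of the integrated variance. -/
lemma exists_abs_integral_fejerCdf_sq_sub_le (h : IsCircularCdf F f f') :
    ∃ C, 0 ≤ C ∧ ∀ m : ℕ, 1 ≤ m →
      |((∫ x in (-Real.pi)..Real.pi, f x * fejerCdfSqIntegral m x) -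
          ∫ x in (-Real.pi)..Real.pi, F x) +
        2 * Real.log m / (Real.pi * m) * (1 + 2 * Real.pi * f (-Real.pi))| ≤ C / m := by
  obtain ⟨M, hM⟩ := isCompact_Icc.exists_bound_of_continuousOn h.density_continuousOn
  have hpi := Real.pi_pos
  have hM0 : 0 ≤ M := (norm_nonneg _).trans (hM 0 ⟨by linarith, hpi.le⟩)
  have hsg := summable_abs_div_succ (summable_cosCoeff_sq h.sqInt_id_mul_deriv)
  have hsg' : Summable (fun k : ℕ =>
      |(-1) ^ k * (cosCoeff (fun x => f x + x * f' x) (k + 1) / ((k : ℝ) + 1))|) := by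
    simpa [abs_mul] using hsg
  set A := ∑' k : ℕ, |(-1) ^ k * cosCoeff f (k + 1) / ((k : ℝ) + 1)|
  set B := ∑' k : ℕ, |(-1) ^ k * sinCoeff f (k + 1)|
  set G := ∑' k : ℕ, |(-1) ^ k * (cosCoeff (fun x => f x + x * f' x) (k + 1) / ((k : ℝ) + 1))|
  have hA0 : 0 ≤ A := tsum_nonneg fun _ => abs_nonneg _
  have hB0 : 0 ≤ B := tsum_nonneg fun _ => abs_nonneg _
  have hG0 : 0 ≤ G := tsum_nonneg fun _ => abs_nonneg _
  set c := 1 + 2 * Real.pi * f (-Real.pi)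
  -- One summand for each of the bounds `t1` to `t6` below.
  refine ⟨4 / Real.pi + 2 / Real.pi * A + 2 * B + 2 / Real.pi * G + 8 * M +
    2 / Real.pi * |c| * 5, by positivity, fun m hm => ?_⟩
  have hmpos : (0 : ℝ) < m := by exact_mod_cast hm
  have hdiv : ∀ x : ℝ, 0 ≤ x → x / ((m : ℝ) + 1) ≤ x / m := fun x hx => by gcongr; linarith
  have bL := abs_tsum_fejerDefect_div_sub_le hm
  have bA := (abs_tsum_fejerDefect_mul_le h.summable_abs_signed_cosCoeff_div m).trans (hdiv A hA0)
  have bB := (abs_tsum_fejerDefect_mul_le h.summable_abs_signed_sinCoeff m).trans (hdiv B hB0)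
  have bG := (abs_tsum_fejerDefect_mul_le hsg' m).trans (hdiv G hG0)
  have bS := (tsum_fejerDefect_sq_le m).trans (hdiv 4 (by norm_num))
  have bS0 : 0 ≤ ∑' k, fejerDefect m k ^ 2 := tsum_nonneg fun _ => sq_nonneg _
  have bE := (integral_sawtoothError_sq_le m).trans (hdiv (4 * Real.pi) (by positivity))
  -- Boundedness of f suffices here, since the sawtooth error has squared L² norm O(1/m).
  have bF : |∫ x in (-Real.pi)..Real.pi, f x * sawtoothError m x ^ 2| ≤
      M * (4 * Real.pi / m) := by
    have h1 : ‖∫ x in (-Real.pi)..Real.pi, f x * sawtoothError m x ^ 2‖ ≤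
        ∫ x in (-Real.pi)..Real.pi, M * sawtoothError m x ^ 2 := by
      refine intervalIntegral.norm_integral_le_of_norm_le neg_pi_lt_pi.le ?_ ?_
      · refine Eventually.of_forall fun x hx => ?_
        rw [norm_mul, Real.norm_eq_abs (_ ^ 2), abs_of_nonneg (sq_nonneg _)]
        exact mul_le_mul_of_nonneg_right (hM x (Ioc_subset_Icc_self hx)) (sq_nonneg _)
      · exact (((continuous_sawtoothError m).pow 2).intervalIntegrable _ _).const_mul _
    rw [intervalIntegral.integral_const_mul] at h1
    exact h1.trans (by gcongr)
  -- The alternating sign of the jump term meets that of the sawtooth error; their product is 1, so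
  -- the logarithmic sum appears a second time.
  have hxf : ∫ x in (-Real.pi)..Real.pi, x * f x * sawtoothError m x =
      -(2 * Real.pi * f (-Real.pi)) * (∑' k : ℕ, fejerDefect m k * (1 / ((k : ℝ) + 1))) -
      ∑' k : ℕ, fejerDefect m k *
        ((-1) ^ k * (cosCoeff (fun x => f x + x * f' x) (k + 1) / ((k : ℝ) + 1))) := by
    rw [integral_mul_sawtoothError (g := fun x => x * f x) (sqInt_of_continuousOn
      (continuousOn_id.mul h.density_continuousOn)), ← tsum_mul_left, ← Summable.tsum_sub
      ((summable_fejerDefect_div m).mul_left _) (summable_fejerDefect_mul hsg' m), ← tsum_neg]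
    refine tsum_congr fun k => ?_
    have hsq : ((-1 : ℝ) ^ k) * (-1) ^ k = 1 := by rw [← pow_add, ← two_mul, pow_mul]; norm_num
    rw [h.sinCoeff_id_mul]
    linear_combination (-fejerDefect m k * (2 * Real.pi * f (-Real.pi)) / ((k : ℝ) + 1)) * hsq
  rw [h.integral_mul_fejerCdfSqIntegral, hxf, integral_mul_sawtoothError h.sqInt_density]
  set L := ∑' k : ℕ, fejerDefect m k * (1 / ((k : ℝ) + 1))
  set S := ∑' k : ℕ, fejerDefect m k ^ 2
  set a := ∑' k : ℕ, fejerDefect m k * ((-1) ^ k * cosCoeff f (k + 1) / ((k : ℝ) + 1))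
  set b := ∑' k : ℕ, fejerDefect m k * ((-1) ^ k * sinCoeff f (k + 1))
  set g := ∑' k : ℕ, fejerDefect m k *
        ((-1) ^ k * (cosCoeff (fun x => f x + x * f' x) (k + 1) / ((k : ℝ) + 1)))
  set E := ∫ x in (-Real.pi)..Real.pi, f x * sawtoothError m x ^ 2
  -- The two occurrences of L combine to the coefficient -(2/π) c; what is left is O(1/m) term by
  -- term.
  have e : -(2 / Real.pi) * L + S / Real.pi - 2 / Real.pi * a - 2 * -b +
      2 / Real.pi * (-(2 * Real.pi * f (-Real.pi)) * L - g) + 2 / Real.pi * E +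
      2 * Real.log m / (Real.pi * m) * c =
      S / Real.pi - 2 / Real.pi * a + 2 * b - 2 / Real.pi * g + 2 / Real.pi * E -
        2 / Real.pi * c * (L - Real.log m / m) := by
    simp only [c]
    field_simp
    ring
  rw [e]
  have t1 : |S / Real.pi| ≤ 4 / Real.pi / m := by
    rw [abs_of_nonneg (by positivity), div_right_comm]
    gcongr
  have t2 : |2 / Real.pi * a| ≤ 2 / Real.pi * A / m := by
    rw [abs_mul, abs_of_pos (by positivity), mul_div_assoc]
    gcongr
  have t3 : |2 * b| ≤ 2 * B / m := by
    rw [abs_mul, abs_of_pos (by positivity), mul_div_assoc]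
    gcongr
  have t4 : |2 / Real.pi * g| ≤ 2 / Real.pi * G / m := by
    rw [abs_mul, abs_of_pos (by positivity), mul_div_assoc]
    gcongr
  have t5 : |2 / Real.pi * E| ≤ 8 * M / m := by
    rw [abs_mul, abs_of_pos (by positivity)]
    calc _ ≤ 2 / Real.pi * (M * (4 * Real.pi / m)) := by gcongr
      _ = _ := by field_simp; ring
  have t6 : |2 / Real.pi * c * (L - Real.log m / m)| ≤ 2 / Real.pi * |c| * 5 / m := by
    rw [abs_mul, abs_mul, abs_of_pos (by positivity : 0 < 2 / Real.pi), mul_div_assoc]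
    gcongr
  simp only [add_div]
  have := abs_le.1 t1
  have := abs_le.1 t2
  have := abs_le.1 t3
  have := abs_le.1 t4
  have := abs_le.1 t5
  have := abs_le.1 t6
  rw [abs_le]
  constructor <;> linarith

end IsCircularCdf

/-! ### From the half-open interval to [-π, π], by assigning values at π. -/

lemma intervalIntegral_congr_Ico {u v : ℝ → ℝ} (huv : ∀ x ∈ Ico (-Real.pi) Real.pi, u x = v x) :
    ∫ x in (-Real.pi)..Real.pi, u x = ∫ x in (-Real.pi)..Real.pi, v x := by
  apply intervalIntegral.integral_congr_ae
  filter_upwards [(countable_singleton Real.pi).ae_notMem volume] with x hx hx'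
  rw [uIoc_of_le neg_pi_lt_pi.le] at hx'
  exact huv x ⟨hx'.1.le, lt_of_le_of_ne hx'.2 hx⟩

lemma update_pi_of_mem_Ico (u : ℝ → ℝ) (c : ℝ) :
    ∀ x ∈ Ico (-Real.pi) Real.pi, Function.update u Real.pi c x = u x :=
  fun _ hx => Function.update_of_ne hx.2.ne _ _

lemma continuousOn_update_pi {u : ℝ → ℝ} {c : ℝ} (hu : ContinuousOn u (Ico (-Real.pi) Real.pi))
    (hc : Tendsto u (𝓝[<] Real.pi) (𝓝 c)) :
    ContinuousOn (Function.update u Real.pi c) (Icc (-Real.pi) Real.pi) := by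
  rw [continuousOn_update_iff, Icc_sdiff_right, nhdsWithin_Ico_eq_nhdsLT neg_pi_lt_pi]
  exact ⟨hu, fun _ => hc⟩

lemma hasDerivAt_update_pi {u : ℝ → ℝ} {c : ℝ}
    (hu : DifferentiableOn ℝ u (Ico (-Real.pi) Real.pi)) {x : ℝ}
    (hx : x ∈ Ioo (-Real.pi) Real.pi) :
    HasDerivAt (Function.update u Real.pi c) (derivWithin u (Ico (-Real.pi) Real.pi) x) x := by
  have h := (hu x ⟨hx.1.le, hx.2⟩).hasDerivWithinAt.hasDerivAt (Ico_mem_nhds hx.1 hx.2)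
  refine h.congr_of_eventuallyEq ?_
  filter_upwards [Iio_mem_nhds hx.2] with y hy
  exact Function.update_of_ne (ne_of_lt hy) _ _

/-- The value at `π` completes a distribution function on `[-π, π)` to one on `[-π, π]`. -/
lemma isCircularCdf_update {F : ℝ → ℝ} (hF0 : F (-Real.pi) = 0)
    (hF1 : Tendsto F (𝓝[<] Real.pi) (𝓝 1))
    (hF : ContDiffOn ℝ 2 F (Ico (-Real.pi) Real.pi))
    (hper : Tendsto (density F) (𝓝[<] Real.pi) (𝓝 (density F (-Real.pi))))
    (hsq : IntegrableOn (fun θ => derivWithin (density F) (Ico (-Real.pi) Real.pi) θ ^ 2)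
      (Ico (-Real.pi) Real.pi)) :
    IsCircularCdf (Function.update F Real.pi 1)
      (Function.update (density F) Real.pi (density F (-Real.pi)))
      (derivWithin (density F) (Ico (-Real.pi) Real.pi)) where
  continuousOn := continuousOn_update_pi hF.continuousOn hF1
  hasDerivAt x hx := by
    rw [update_pi_of_mem_Ico _ _ x ⟨hx.1.le, hx.2⟩]
    exact hasDerivAt_update_pi (hF.differentiableOn (by norm_num)) hx
  map_neg_pi := by rw [Function.update_of_ne neg_pi_lt_pi.ne, hF0]
  map_pi := Function.update_self _ _ _
  density_continuousOn := continuousOn_update_pi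
    (hF.continuousOn_derivWithin (uniqueDiffOn_Ico _ _) (by norm_num)) hper
  density_hasDerivAt x hx := by
    have h : ContDiffOn ℝ 1 (density F) (Ico (-Real.pi) Real.pi) :=
      hF.derivWithin (uniqueDiffOn_Ico _ _) (by norm_num)
    exact hasDerivAt_update_pi (h.differentiableOn (by norm_num)) hx
  density_periodic := by rw [Function.update_self, Function.update_of_ne neg_pi_lt_pi.ne]
  sqInt_deriv := by
    have h : ContDiffOn ℝ 1 (density F) (Ico (-Real.pi) Real.pi) :=
      hF.derivWithin (uniqueDiffOn_Ico _ _) (by norm_num)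
    have hc := h.continuousOn_derivWithin (uniqueDiffOn_Ico _ _) le_rfl
    rw [SqInt, ← restrict_Ico_eq_restrict_Ioc,
      memLp_two_iff_integrable_sq (hc.aestronglyMeasurable measurableSet_Ico)]
    exact hsq

lemma cosMoment_eq_cosCoeff_update (F : ℝ → ℝ) (c : ℝ) (k : ℕ) :
    cosMoment F k = cosCoeff (Function.update (density F) Real.pi c) k :=
  intervalIntegral_congr_Ico fun x hx => by rw [update_pi_of_mem_Ico _ _ x hx]

lemma sinMoment_eq_sinCoeff_update (F : ℝ → ℝ) (c : ℝ) (k : ℕ) :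
    sinMoment F k = sinCoeff (Function.update (density F) Real.pi c) k :=
  intervalIntegral_congr_Ico fun x hx => by rw [update_pi_of_mem_Ico _ _ x hx]

/-- The two index shifts contribute the sign +1, and the term splits into a product; this makes the
double series a square. -/
lemma theta2Double_eq (F : ℝ → ℝ) (p : ℕ × ℕ) :
    theta2Double F p =
      ((-1) ^ p.1 * sinMoment F (p.1 + 1)) * ((-1) ^ p.2 * sinMoment F (p.2 + 1)) := by
  rw [theta2Double]
  ring

section Moments

variable {F f' : ℝ → ℝ} {c : ℝ}

lemma summable_theta2Single {G : ℝ → ℝ}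
    (h : IsCircularCdf G (Function.update (density F) Real.pi c) f') :
    Summable (theta2Single F) := by
  have := (hasSum_sq_coeff h.sqInt_density).summable
  simp only [← cosMoment_eq_cosCoeff_update, ← sinMoment_eq_sinCoeff_update] at this
  exact this

lemma summable_signed_sinMoment {G : ℝ → ℝ}
    (h : IsCircularCdf G (Function.update (density F) Real.pi c) f') :
    Summable (fun k : ℕ => ‖(-1) ^ k * sinMoment F (k + 1)‖) := by
  have := h.summable_abs_signed_sinCoeff
  simp only [← sinMoment_eq_sinCoeff_update] at this
  exact this

lemma summable_theta2Double {G : ℝ → ℝ}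
    (h : IsCircularCdf G (Function.update (density F) Real.pi c) f') :
    Summable (theta2Double F) := by
  have := summable_mul_of_summable_norm (summable_signed_sinMoment h) (summable_signed_sinMoment h)
  simpa only [← theta2Double_eq] using this

/-- The Cauchy product of an absolutely convergent series with itself. This is the form of the bias
limit, and it shows θ₂ ≥ 0. -/
lemma theta2_eq {G : ℝ → ℝ}
    (h : IsCircularCdf G (Function.update (density F) Real.pi c) f') :
    theta2 F = 1 / Real.pi * (∑' k : ℕ,
        (cosCoeff (Function.update (density F) Real.pi c) (k + 1) ^ 2 +
          sinCoeff (Function.update (density F) Real.pi c) (k + 1) ^ 2)) +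
      2 / Real.pi * (∑' k : ℕ,
        (-1) ^ k * sinCoeff (Function.update (density F) Real.pi c) (k + 1)) ^ 2 := by
  simp only [← cosMoment_eq_cosCoeff_update, ← sinMoment_eq_sinCoeff_update]
  rw [sq, tsum_mul_tsum_of_summable_norm (summable_signed_sinMoment h)
    (summable_signed_sinMoment h)]
  simp only [← theta2Double_eq]
  rfl

end Moments

/-! ### The law of one observation. -/

section Law

variable {Ω : Type*} [MeasurableSpace Ω] {P : Measure Ω} [IsProbabilityMeasure P]

/-- The left limit at π is the mass of (-∞, π), which is everything because the variable is almost
surely less than π. -/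
lemma tendsto_cdf_left {Y : Ω → ℝ} {F : ℝ → ℝ} (hY : Measurable Y)
    (hsupp : ∀ᵐ ω ∂P, Y ω ∈ Ico (-Real.pi) Real.pi)
    (hcdf : ∀ θ ∈ Ico (-Real.pi) Real.pi, P.real {ω | Y ω ≤ θ} = F θ) :
    Tendsto F (𝓝[<] Real.pi) (𝓝 1) := by
  have : IsProbabilityMeasure (P.map Y) := Measure.isProbabilityMeasure_map hY.aemeasurable
  have h1 := (cdf (P.map Y)).measure_Iio (tendsto_cdf_atBot _) Real.pi
  rw [measure_cdf, Measure.map_apply hY measurableSet_Iio, sub_zero] at h1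
  have h2 : P (Y ⁻¹' Iio Real.pi) = 1 := by
    exact (mem_ae_iff_prob_eq_one (hY measurableSet_Iio)).1 (hsupp.mono fun ω hω => hω.2)
  have h3 : Function.leftLim (cdf (P.map Y)) Real.pi = 1 := by
    rw [h2] at h1
    exact (ENNReal.ofReal_eq_one.1 h1.symm)
  have h4 := (monotone_cdf (P.map Y)).tendsto_leftLim Real.pi
  rw [h3] at h4
  refine h4.congr' ?_
  filter_upwards [Ioo_mem_nhdsLT neg_pi_lt_pi] with θ hθ
  rw [cdf_eq_real, map_measureReal_apply hY measurableSet_Iic, ← hcdf θ ⟨hθ.1.le, hθ.2⟩]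
  rfl

/-- A finite measure on the line is determined by half-lines, and on those the fundamental theorem
of calculus applies. There is no atom at -π since F(-π) = 0. -/
lemma map_eq_withDensity {Y : Ω → ℝ} {F f f' : ℝ → ℝ} (h : IsCircularCdf F f f')
    (hf : ∀ x ∈ Icc (-Real.pi) Real.pi, 0 ≤ f x) (hY : Measurable Y)
    (hsupp : ∀ᵐ ω ∂P, Y ω ∈ Ico (-Real.pi) Real.pi)
    (hcdf : ∀ θ ∈ Ico (-Real.pi) Real.pi, P.real {ω | Y ω ≤ θ} = F θ) :
    P.map Y = (volume.restrict (Ioc (-Real.pi) Real.pi)).withDensity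
      (fun x => ENNReal.ofReal (f x)) := by
  have : IsProbabilityMeasure (P.map Y) := Measure.isProbabilityMeasure_map hY.aemeasurable
  have hint : ∀ a ∈ Icc (-Real.pi) Real.pi,
      ∫⁻ x in Ioc (-Real.pi) a, ENNReal.ofReal (f x) = ENNReal.ofReal (F a) := fun a ha => by
    have hsub : Icc (-Real.pi) a ⊆ Icc (-Real.pi) Real.pi := Icc_subset_Icc_right ha.2
    have hi : IntervalIntegrable f volume (-Real.pi) a :=
      ContinuousOn.intervalIntegrable_of_Icc ha.1 (h.density_continuousOn.mono hsub)
    rw [← ofReal_integral_eq_lintegral_ofReal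
      ((intervalIntegrable_iff_integrableOn_Ioc_of_le ha.1).1 hi)
      ((ae_restrict_mem measurableSet_Ioc).mono fun x hx => hf x (hsub (Ioc_subset_Icc_self hx))),
      ← intervalIntegral.integral_of_le ha.1,
      intervalIntegral.integral_eq_sub_of_hasDerivAt_of_le ha.1 (h.continuousOn.mono hsub)
        (fun x hx => h.hasDerivAt x ⟨hx.1, hx.2.trans_le ha.2⟩) hi, h.map_neg_pi, sub_zero]
  apply Measure.ext_of_Iic
  intro a
  rw [Measure.map_apply hY measurableSet_Iic, withDensity_apply _ measurableSet_Iic,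
    Measure.restrict_restrict measurableSet_Iic, inter_comm, Ioc_inter_Iic]
  rcases lt_or_ge a (-Real.pi) with ha | ha
  · rw [Ioc_eq_empty (by
      rw [min_eq_right (ha.le.trans neg_pi_lt_pi.le)]
      exact ha.not_gt), Measure.restrict_empty, lintegral_zero_measure]
    exact measure_eq_zero_iff_ae_notMem.2 (hsupp.mono fun ω hω hω' => (hω.1.trans hω').not_gt ha)
  rcases lt_or_ge a Real.pi with ha' | ha'
  · rw [min_eq_right ha'.le, hint a ⟨ha, ha'.le⟩, ← hcdf a ⟨ha, ha'⟩, ofReal_measureReal]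
    rfl
  · rw [min_eq_left ha', hint _ ⟨neg_pi_lt_pi.le, le_rfl⟩, h.map_pi, ENNReal.ofReal_one]
    exact (mem_ae_iff_prob_eq_one (hY measurableSet_Iic)).1
      (hsupp.mono fun ω hω => hω.2.le.trans ha')

lemma integral_comp_eq {Y : Ω → ℝ} {F f f' : ℝ → ℝ} (h : IsCircularCdf F f f')
    (hf : ∀ x ∈ Icc (-Real.pi) Real.pi, 0 ≤ f x) (hY : Measurable Y)
    (hsupp : ∀ᵐ ω ∂P, Y ω ∈ Ico (-Real.pi) Real.pi)
    (hcdf : ∀ θ ∈ Ico (-Real.pi) Real.pi, P.real {ω | Y ω ≤ θ} = F θ)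
    {u : ℝ → ℝ} (hu : Continuous u) :
    ∫ ω, u (Y ω) ∂P = ∫ x in (-Real.pi)..Real.pi, f x * u x := by
  rw [← integral_map hY.aemeasurable hu.aestronglyMeasurable,
    map_eq_withDensity h hf hY hsupp hcdf, integral_withDensity_eq_integral_toReal_smul₀
    (h.sqInt_density.aestronglyMeasurable.aemeasurable.ennreal_ofReal) (by simp),
    intervalIntegral.integral_of_le neg_pi_lt_pi.le]
  refine setIntegral_congr_fun measurableSet_Ioc fun x hx => ?_
  simp only [smul_eq_mul]
  rw [ENNReal.toReal_ofReal (hf x (Ioc_subset_Icc_self hx))]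

end Law

/-! ### The estimator as an average of single contributions. -/

lemma fejerKernel_eq (m : ℕ) (s : ℝ) :
    fejerKernel m s = 1 / (2 * Real.pi) + 1 / Real.pi * ∑ k ∈ Finset.range m,
      fejerWeight m k * (((k : ℝ) + 1) * Real.cos (((k + 1 : ℕ) : ℝ) * s)) := by
  rw [fejerKernel]
  congr 2
  rw [show Finset.Icc 1 m = Finset.Ico (0 + 1) (m + 1) by ext; simp,
    ← Finset.sum_Ico_add', ← Finset.range_eq_Ico]
  refine Finset.sum_congr rfl fun k hk => ?_
  rw [fejerWeight_of_lt (Finset.mem_range.1 hk)]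
  have : (k : ℝ) + 1 ≠ 0 := by positivity
  push_cast
  field_simp

lemma continuous_fejerKernel (m : ℕ) : Continuous (fejerKernel m) := by
  unfold fejerKernel
  fun_prop

lemma hasDerivAt_fejerCdf (m : ℕ) (x θ : ℝ) :
    HasDerivAt (fun θ => fejerCdf m θ x) (fejerKernel m (θ - x)) θ := by
  simp only [fejerCdf_eq]
  have h1 : ∀ k ∈ Finset.range m, HasDerivAt
      (fun θ => fejerWeight m k * Real.sin (((k + 1 : ℕ) : ℝ) * (θ - x)))
      (fejerWeight m k * (((k : ℝ) + 1) * Real.cos (((k + 1 : ℕ) : ℝ) * (θ - x)))) θ := by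
    intro k _
    have := ((((hasDerivAt_id' θ).sub_const x).const_mul (((k + 1 : ℕ) : ℝ))).sin).const_mul
      (fejerWeight m k)
    refine this.congr_deriv ?_
    push_cast
    ring
  have h2 := (((hasDerivAt_id' θ).div_const (2 * Real.pi)).const_add
    (1 / 2 - fejerSawtooth m x / Real.pi)).fun_add ((HasDerivAt.fun_sum h1).div_const Real.pi)
  refine h2.congr_deriv ?_
  rw [fejerKernel_eq]
  ring

/-- At θ = -π the sine sum becomes the sawtooth mean at x; this explains the constant term 1/2 -
S_m(x)/π, where S_m is `fejerSawtooth m`. -/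
lemma fejerCdf_neg_pi (m : ℕ) (x : ℝ) : fejerCdf m (-Real.pi) x = 0 := by
  rw [fejerCdf_eq]
  have e : ∑ k ∈ Finset.range m, fejerWeight m k * Real.sin (((k + 1 : ℕ) : ℝ) * (-Real.pi - x)) =
      fejerSawtooth m x := by
    rw [fejerSawtooth]
    refine Finset.sum_congr rfl fun k _ => ?_
    rw [mul_sub, mul_neg, Real.sin_sub, Real.sin_neg, Real.cos_neg, Real.sin_nat_mul_pi,
      cos_nat_succ_mul_pi]
    ring
  rw [e]
  have := Real.pi_ne_zero
  field_simp
  ring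

lemma cdfEstimator_eq (m n : ℕ) (x : ℕ → ℝ) (θ : ℝ) :
    cdfEstimator m n x θ = 1 / (n : ℝ) * ∑ j ∈ Finset.range n, fejerCdf m θ (x j) := by
  have hK := continuous_fejerKernel m
  have hI : ∀ j, IntervalIntegrable (fun y => fejerKernel m (y - x j)) volume (-Real.pi) θ :=
    fun j => Continuous.intervalIntegrable (by fun_prop) _ _
  simp only [cdfEstimator, densityEstimator]
  rw [intervalIntegral.integral_const_mul, intervalIntegral.integral_finsetSum fun j _ => hI j]
  congr 1
  refine Finset.sum_congr rfl fun j _ => ?_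
  rw [intervalIntegral.integral_eq_sub_of_hasDerivAt
    (fun y _ => hasDerivAt_fejerCdf m (x j) y) (hI j), fejerCdf_neg_pi, sub_zero]

/-- For fixed m a bound uniform in θ and x is enough: it supplies integrability for Fubini and
square integrability for the variance. -/
lemma exists_abs_fejerCdf_le (m : ℕ) :
    ∃ C, 0 ≤ C ∧ ∀ θ ∈ Icc (-Real.pi) Real.pi, ∀ x, |fejerCdf m θ x| ≤ C := by
  have hpi := Real.pi_pos
  set W := ∑ k ∈ Finset.range m, |fejerWeight m k|
  have hW : 0 ≤ W := Finset.sum_nonneg fun _ _ => abs_nonneg _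
  refine ⟨1 / 2 + W / Real.pi + 1 / 2 + W / Real.pi, by positivity, fun θ hθ x => ?_⟩
  have h1 : |fejerSawtooth m x| ≤ W := by
    refine (Finset.abs_sum_le_sum_abs _ _).trans (Finset.sum_le_sum fun k _ => ?_)
    rw [abs_mul, abs_mul, abs_pow, abs_neg, abs_one, one_pow, mul_one]
    exact mul_le_of_le_one_right (abs_nonneg _) (Real.abs_sin_le_one _)
  have h2 : |∑ k ∈ Finset.range m, fejerWeight m k * Real.sin (((k + 1 : ℕ) : ℝ) * (θ - x))| ≤
      W := by
    refine (Finset.abs_sum_le_sum_abs _ _).trans (Finset.sum_le_sum fun k _ => ?_)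
    rw [abs_mul]
    exact mul_le_of_le_one_right (abs_nonneg _) (Real.abs_sin_le_one _)
  have h3 : |θ / (2 * Real.pi)| ≤ 1 / 2 := by
    rw [abs_div, abs_of_pos (by positivity : 0 < 2 * Real.pi), div_le_div_iff₀ (by positivity)
      (by norm_num)]
    linarith [abs_le.2 hθ]
  have h4 : |fejerSawtooth m x / Real.pi| ≤ W / Real.pi := by
    rw [abs_div, abs_of_pos hpi]
    gcongr
  have h5 : |(∑ k ∈ Finset.range m, fejerWeight m k * Real.sin (((k + 1 : ℕ) : ℝ) * (θ - x))) /
      Real.pi| ≤ W / Real.pi := by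
    rw [abs_div, abs_of_pos hpi]
    gcongr
  rw [fejerCdf_eq]
  rw [abs_le] at *
  constructor <;> linarith

lemma continuous_fejerCdf_right (m : ℕ) (θ : ℝ) : Continuous (fejerCdf m θ) := by
  have hS := continuous_fejerSawtooth m
  have e : fejerCdf m θ = fun x => 1 / 2 - fejerSawtooth m x / Real.pi + θ / (2 * Real.pi) +
      (∑ k ∈ Finset.range m, fejerWeight m k * Real.sin (((k + 1 : ℕ) : ℝ) * (θ - x))) /
        Real.pi := funext fun x => fejerCdf_eq m θ x
  rw [e]
  fun_prop

/-! ### Bias–variance decomposition. -/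

section MISE

variable {Ω : Type*} [MeasurableSpace Ω] {P : Measure Ω} [IsProbabilityMeasure P]
  {X : ℕ → Ω → ℝ} {F f f' : ℝ → ℝ}

/-- Bias–variance decomposition at a point, for the mean of i.i.d. square integrable variables. -/
lemma integral_mean_sub_sq {Y : ℕ → Ω → ℝ} (hY : ∀ i, MemLp (Y i) 2 P)
    (hind : Pairwise fun i j => IndepFun (Y i) (Y j) P) {μ s : ℝ}
    (hμ : ∀ i, ∫ ω, Y i ω ∂P = μ) (hs : ∀ i, ∫ ω, Y i ω ^ 2 ∂P = s) (c : ℝ) {n : ℕ}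
    (hn : 1 ≤ n) :
    ∫ ω, (1 / (n : ℝ) * (∑ j ∈ Finset.range n, Y j ω) - c) ^ 2 ∂P =
      1 / (n : ℝ) * (s - μ ^ 2) + (μ - c) ^ 2 := by
  have hn0 : (n : ℝ) ≠ 0 := by positivity
  have hS : MemLp (fun ω => ∑ j ∈ Finset.range n, Y j ω) 2 P := memLp_finsetSum _ fun i _ => hY i
  have hZ : MemLp (fun ω => 1 / (n : ℝ) * (∑ j ∈ Finset.range n, Y j ω)) 2 P := hS.const_mul _
  have hvar : variance (fun ω => 1 / (n : ℝ) * (∑ j ∈ Finset.range n, Y j ω) - c) P =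
      1 / (n : ℝ) * (s - μ ^ 2) := by
    rw [variance_sub_const hZ.aestronglyMeasurable, variance_const_mul]
    have h := IndepFun.variance_sum (s := Finset.range n) (fun i _ => hY i)
      (fun i _ j _ hij => hind hij)
    rw [show (∑ i ∈ Finset.range n, Y i) = fun ω => ∑ j ∈ Finset.range n, Y j ω by
      ext; simp] at h
    have hv : ∀ i ∈ Finset.range n, variance (Y i) P = s - μ ^ 2 := fun i _ => by
      rw [variance_eq_sub (hY i), hμ i, ← hs i]
      rfl
    rw [h, Finset.sum_congr rfl hv, Finset.sum_const, Finset.card_range, nsmul_eq_mul]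
    field_simp
  have hmean : ∫ ω, (1 / (n : ℝ) * (∑ j ∈ Finset.range n, Y j ω) - c) ∂P = μ - c := by
    rw [integral_sub (hZ.integrable (by norm_num)) (integrable_const c), integral_const_mul,
      integral_finsetSum _ fun i _ => (hY i).integrable (by norm_num),
      Finset.sum_congr rfl fun i _ => hμ i, Finset.sum_const, Finset.card_range, nsmul_eq_mul]
    simp only [integral_const, probReal_univ, smul_eq_mul, one_mul]
    field_simp
  have h := variance_eq_sub (hZ.sub (memLp_const c))
  have e : ((fun ω => 1 / (n : ℝ) * (∑ j ∈ Finset.range n, Y j ω)) - fun _ => c) =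
      fun ω => 1 / (n : ℝ) * (∑ j ∈ Finset.range n, Y j ω) - c := rfl
  rw [e, hvar, hmean] at h
  simp only [Pi.pow_apply] at h
  linarith

lemma measurable_fejerCdf_comp {Y : Ω → ℝ} (hY : Measurable Y) (m : ℕ) :
    Measurable (fun p : ℝ × Ω => fejerCdf m p.1 (Y p.2)) := by
  have hS := (continuous_fejerSawtooth m).measurable
  simp only [fejerCdf_eq]
  fun_prop

lemma memLp_fejerCdf_comp {Y : Ω → ℝ} (hY : Measurable Y) (m : ℕ) {θ : ℝ}
    (hθ : θ ∈ Icc (-Real.pi) Real.pi) : MemLp (fun ω => fejerCdf m θ (Y ω)) 2 P := by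
  obtain ⟨C, -, hC⟩ := exists_abs_fejerCdf_le m
  have hc := continuous_fejerCdf_right m θ
  refine MemLp.of_bound (hc.measurable.comp hY).aestronglyMeasurable C
    (Eventually.of_forall fun ω => ?_)
  rw [Real.norm_eq_abs]
  exact hC θ hθ _

/-- The bias–variance decomposition of the mean integrated squared error. -/
lemma cdfMISE_eq (h : IsCircularCdf F f f') (hf : ∀ x ∈ Icc (-Real.pi) Real.pi, 0 ≤ f x)
    (hX : ∀ i, Measurable (X i)) (hindep : iIndepFun X P)
    (hsupp : ∀ i, ∀ᵐ ω ∂P, X i ω ∈ Ico (-Real.pi) Real.pi)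
    (hcdf : ∀ i, ∀ θ ∈ Ico (-Real.pi) Real.pi, P.real {ω | X i ω ≤ θ} = F θ)
    (m : ℕ) {n : ℕ} (hn : 1 ≤ n) :
    cdfMISE P X F m n =
      1 / (n : ℝ) * ((∫ x in (-Real.pi)..Real.pi, f x * fejerCdfSqIntegral m x) -
        ∫ θ in (-Real.pi)..Real.pi, fejerMean f m θ ^ 2) +
      ∫ θ in (-Real.pi)..Real.pi, (fejerMean f m θ - F θ) ^ 2 := by
  obtain ⟨C, hC0, hC⟩ := exists_abs_fejerCdf_le m
  obtain ⟨M, hM⟩ := isCompact_Icc.exists_bound_of_continuousOn h.continuousOn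
  have hFm : AEStronglyMeasurable F (volume.restrict (Ioc (-Real.pi) Real.pi)) :=
    h.sqInt.aestronglyMeasurable
  have hGm : ∀ j, Measurable (fun p : ℝ × Ω => fejerCdf m p.1 (X j p.2)) := fun j =>
    measurable_fejerCdf_comp (hX j) m
  have hmean : ∀ θ i, ∫ ω, fejerCdf m θ (X i ω) ∂P = fejerMean f m θ := fun θ i => by
    rw [integral_comp_eq h hf (hX i) (hsupp i) (hcdf i) (continuous_fejerCdf_right m θ),
      h.integral_mul_fejerCdf]
  have hae : ∀ᵐ p ∂((volume.restrict (uIoc (-Real.pi) Real.pi)).prod P),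
      p.1 ∈ Icc (-Real.pi) Real.pi := by
    have : ∀ᵐ θ ∂(volume.restrict (uIoc (-Real.pi) Real.pi)), θ ∈ Icc (-Real.pi) Real.pi := by
      rw [uIoc_of_le neg_pi_lt_pi.le]
      exact (ae_restrict_mem measurableSet_Ioc).mono fun θ hθ => Ioc_subset_Icc_self hθ
    exact Measure.quasiMeasurePreserving_fst.ae this
  have hfin : IsFiniteMeasure ((volume : Measure ℝ).restrict (uIoc (-Real.pi) Real.pi)) := by
    rw [uIoc_of_le neg_pi_lt_pi.le]
    infer_instance
  have hint1 : Integrable (Function.uncurry fun (θ : ℝ) (ω : Ω) =>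
      (1 / (n : ℝ) * (∑ j ∈ Finset.range n, fejerCdf m θ (X j ω)) - F θ) ^ 2)
      ((volume.restrict (uIoc (-Real.pi) Real.pi)).prod P) := by
    have hmeas : AEStronglyMeasurable (fun p : ℝ × Ω =>
        1 / (n : ℝ) * (∑ j ∈ Finset.range n, fejerCdf m p.1 (X j p.2)) - F p.1)
        ((volume.restrict (uIoc (-Real.pi) Real.pi)).prod P) := by
      rw [uIoc_of_le neg_pi_lt_pi.le]
      exact ((Finset.measurable_fun_sum _ fun j _ => hGm j).const_mul _).aestronglyMeasurable.sub
        hFm.comp_fst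
    refine Integrable.of_bound (hmeas.pow 2) ((C + M) ^ 2) ?_
    filter_upwards [hae] with p hp
    simp only [Function.uncurry]
    rw [Real.norm_eq_abs, abs_pow]
    gcongr
    refine (abs_sub _ _).trans (add_le_add ?_ (hM _ hp))
    have hn0 : (0 : ℝ) < n := by exact_mod_cast hn
    rw [abs_mul, abs_of_pos (by positivity), one_div, inv_mul_le_iff₀ hn0]
    refine (Finset.abs_sum_le_sum_abs _ _).trans
      ((Finset.sum_le_sum fun j _ => hC p.1 hp (X j p.2)).trans ?_)
    simp
  have hint2 : Integrable (Function.uncurry fun (θ : ℝ) (ω : Ω) => fejerCdf m θ (X 0 ω) ^ 2)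
      ((volume.restrict (uIoc (-Real.pi) Real.pi)).prod P) := by
    refine Integrable.of_bound ((hGm 0).pow_const 2).aestronglyMeasurable (C ^ 2) ?_
    filter_upwards [hae] with p hp
    simp only [Function.uncurry]
    rw [Real.norm_eq_abs, abs_pow]
    gcongr
    exact hC p.1 hp _
  have hH : Continuous (fejerCdfSqIntegral m) := by
    have := continuous_fejerSawtooth m
    unfold fejerCdfSqIntegral
    fun_prop
  -- Integrating over θ first makes the inner integral the closed form in the observation alone.
  have hsecond : ∫ θ in (-Real.pi)..Real.pi, (∫ ω, fejerCdf m θ (X 0 ω) ^ 2 ∂P) =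
      ∫ x in (-Real.pi)..Real.pi, f x * fejerCdfSqIntegral m x := by
    rw [intervalIntegral_integral_swap hint2]
    simp only [integral_fejerCdf_sq]
    exact integral_comp_eq h hf (hX 0) (hsupp 0) (hcdf 0) hH
  have hsq : ∀ θ i, ∫ ω, fejerCdf m θ (X i ω) ^ 2 ∂P = ∫ ω, fejerCdf m θ (X 0 ω) ^ 2 ∂P :=
    fun θ i => by
      have hu : Continuous fun x => fejerCdf m θ x ^ 2 :=
        (continuous_fejerCdf_right m θ).pow 2
      exact (integral_comp_eq h hf (hX i) (hsupp i) (hcdf i) hu).trans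
        (integral_comp_eq h hf (hX 0) (hsupp 0) (hcdf 0) hu).symm
  have hpt : ∀ θ ∈ Icc (-Real.pi) Real.pi,
      ∫ ω, (1 / (n : ℝ) * (∑ j ∈ Finset.range n, fejerCdf m θ (X j ω)) - F θ) ^ 2 ∂P =
      1 / (n : ℝ) * ((∫ ω, fejerCdf m θ (X 0 ω) ^ 2 ∂P) - fejerMean f m θ ^ 2) +
        (fejerMean f m θ - F θ) ^ 2 := fun θ hθ => by
    have hc := (continuous_fejerCdf_right m θ).measurable
    exact integral_mean_sub_sq (Y := fun j ω => fejerCdf m θ (X j ω))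
      (fun i => memLp_fejerCdf_comp (hX i) m hθ)
      (fun i j hij => (hindep.indepFun hij).comp hc hc) (hmean θ) (hsq θ) (F θ) hn
  simp only [cdfMISE, cdfEstimator_eq]
  rw [← intervalIntegral_integral_swap hint1]
  rw [intervalIntegral.integral_congr (g := fun θ => 1 / (n : ℝ) *
    ((∫ ω, fejerCdf m θ (X 0 ω) ^ 2 ∂P) - fejerMean f m θ ^ 2) + (fejerMean f m θ - F θ) ^ 2)
    fun θ hθ => hpt θ (by rwa [uIcc_of_le neg_pi_lt_pi.le] at hθ)]
  have hiM : IntervalIntegrable (fun θ => fejerMean f m θ ^ 2) volume (-Real.pi) Real.pi :=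
    ((continuous_linearTrig _ _ _ _ _).pow 2).intervalIntegrable _ _
  have hiB : IntervalIntegrable (fun θ => (fejerMean f m θ - F θ) ^ 2) volume
      (-Real.pi) Real.pi := by
    apply ContinuousOn.intervalIntegrable_of_Icc neg_pi_lt_pi.le
    exact ((continuous_linearTrig _ _ _ _ _).continuousOn.sub h.continuousOn).pow 2
  have hiS : IntervalIntegrable (fun θ => ∫ ω, fejerCdf m θ (X 0 ω) ^ 2 ∂P) volume
      (-Real.pi) Real.pi := by
    rw [intervalIntegrable_iff]
    exact hint2.integral_prod_left
  rw [intervalIntegral.integral_add ((hiS.sub hiM).const_mul _) hiB,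
    intervalIntegral.integral_const_mul, intervalIntegral.integral_sub hiS hiM, hsecond]

end MISE

/-! ### Minimization of the AMISE and the Lambert W function. -/

/-- The function `x ↦ x (log x - 1)` is strictly increasing on `[1, ∞)`. -/
lemma strictMonoOn_mul_log_sub_one : StrictMonoOn (fun x : ℝ => x * (Real.log x - 1)) (Ici 1) := by
  apply strictMonoOn_of_deriv_pos (convex_Ici 1)
  · exact continuousOn_id.mul
      ((Real.continuousOn_log.mono fun x hx => (zero_lt_one.trans_le hx).ne').sub continuousOn_const)
  · intro x hx
    rw [interior_Ici] at hx
    have hx0 : (0 : ℝ) < x := zero_lt_one.trans hx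
    have h := (hasDerivAt_id' x).fun_mul ((Real.hasDerivAt_log hx0.ne').sub_const 1)
    rw [h.deriv, mul_inv_cancel₀ hx0.ne']
    linarith [Real.log_pos hx]

/-- The equation `x (log x - 1) = t`, for `t ≥ 0`, has exactly one positive solution; to its left
`x (log x - 1)` is less than `t`, to its right greater. -/
lemma exists_mul_log_sub_one_eq {t : ℝ} (ht : 0 ≤ t) :
    ∃ x : ℝ, Real.exp 1 ≤ x ∧ x * (Real.log x - 1) = t ∧
      (∀ y, 0 < y → y < x → y * (Real.log y - 1) < t) ∧
      (∀ y, x < y → t < y * (Real.log y - 1)) := by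
  have he1 : (1 : ℝ) < Real.exp 1 := by simp
  have hcont : ContinuousOn (fun x : ℝ => x * (Real.log x - 1))
      (Icc (Real.exp 1) (Real.exp (t + 1))) :=
    continuousOn_id.mul ((Real.continuousOn_log.mono fun x hx =>
      ((Real.exp_pos 1).trans_le hx.1).ne').sub continuousOn_const)
  -- The value is 0 at e and t·e^(t+1) ≥ t at e^(t+1), which brackets t.
  obtain ⟨x, hx, hxt⟩ := intermediate_value_Icc
    (Real.exp_le_exp.2 (by linarith : (1 : ℝ) ≤ t + 1)) hcont
    (show t ∈ Icc _ _ by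
      simp only [Real.log_exp, sub_self, mul_zero, add_sub_cancel_right]
      exact ⟨ht, le_mul_of_one_le_left ht (Real.one_le_exp (by linarith))⟩)
  refine ⟨x, hx.1, hxt, fun y hy0 hy => ?_, fun y hy => ?_⟩
  · rcases le_or_gt 1 y with h1 | h1
    · rw [← hxt]
      exact strictMonoOn_mul_log_sub_one h1 (he1.le.trans hx.1) hy
    -- On (0, 1) the function is not increasing, but it is negative, hence below t.
    · have := Real.log_neg hy0 h1
      nlinarith
  · rw [← hxt]
    exact strictMonoOn_mul_log_sub_one (he1.le.trans hx.1) ((he1.le.trans hx.1).trans hy.le) hy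

/-- The minimizer of `K - a log x / x + b / x²` on `(0, ∞)`. -/
lemma isMinOn_sub_log_div_iff {a b K : ℝ} (ha : 0 < a) (hb : 0 ≤ b) {x : ℝ} (hx : 0 < x) :
    IsMinOn (fun y : ℝ => K - a * (Real.log y / y) + b / y ^ 2) (Ioi 0) x ↔
      a * (x * (Real.log x - 1)) = 2 * b := by
  set φ := fun y : ℝ => K - a * (Real.log y / y) + b / y ^ 2 with hφ
  have hder : ∀ y : ℝ, 0 < y →
      HasDerivAt φ ((a * (y * (Real.log y - 1)) - 2 * b) / y ^ 3) y := fun y hy => by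
    have h1 := ((((Real.hasDerivAt_log hy.ne').fun_div (hasDerivAt_id' y) hy.ne').const_mul
      a).const_sub K).fun_add ((hasDerivAt_const y b).fun_div (hasDerivAt_pow 2 y)
        (pow_ne_zero 2 hy.ne'))
    refine h1.congr_deriv ?_
    field_simp
    ring
  constructor
  · intro h
    have h0 := (h.isLocalMin (Ioi_mem_nhds hx)).hasDerivAt_eq_zero (hder x hx)
    rw [div_eq_zero_iff] at h0
    rcases h0 with h0 | h0
    · linarith
    · exact absurd h0 (by positivity)
  · intro h
    -- The critical point is unique and the derivative changes sign there from negative to positive,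
    -- so the critical point is a global minimum.
    obtain ⟨z, hz, hzt, hlt, hgt⟩ := exists_mul_log_sub_one_eq
      (show 0 ≤ 2 * b / a by positivity)
    have hz0 : 0 < z := (Real.exp_pos 1).trans_le hz
    have hx' : x * (Real.log x - 1) = 2 * b / a := by rw [eq_div_iff ha.ne']; linarith
    have hxz : x = z := by
      rcases lt_trichotomy x z with h1 | h1 | h1
      · exact absurd hx' (hlt x hx h1).ne
      · exact h1
      · exact absurd hx' (hgt x h1).ne'
    subst hxz
    have hcont : ContinuousOn φ (Ioi 0) := fun y hy => (hder y hy).continuousAt.continuousWithinAt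
    intro y hy
    rcases le_total y x with hyx | hyx
    · have hanti : AntitoneOn φ (Ioc 0 x) := by
        apply antitoneOn_of_deriv_nonpos (convex_Ioc 0 x) (hcont.mono fun y hy => hy.1)
        · intro y hy
          rw [interior_Ioc] at hy
          exact (hder y hy.1).differentiableAt.differentiableWithinAt
        · intro y hy
          rw [interior_Ioc] at hy
          have hy0 : 0 < y := hy.1
          have := hlt y hy0 hy.2
          rw [lt_div_iff₀ ha] at this
          rw [(hder y hy0).deriv]
          exact div_nonpos_of_nonpos_of_nonneg (by linarith) (by positivity)
      exact hanti ⟨hy, hyx⟩ ⟨hx, le_rfl⟩ hyx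
    · have hmono : MonotoneOn φ (Ici x) := by
        apply monotoneOn_of_deriv_nonneg (convex_Ici x) (hcont.mono fun y hy => hx.trans_le hy)
        · intro y hy
          rw [interior_Ici] at hy
          exact (hder y (hx.trans hy)).differentiableAt.differentiableWithinAt
        · intro y hy
          rw [interior_Ici] at hy
          have hy0 : 0 < y := hx.trans hy
          have := hgt y hy
          rw [div_lt_iff₀ ha] at this
          rw [(hder y hy0).deriv]
          exact div_nonneg (by linarith) (by positivity)
      exact hmono (mem_Ici.2 le_rfl) hyx hyx

lemma cdfAMISE_eq (F : ℝ → ℝ) (m n : ℝ) :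
    cdfAMISE F m n = 1 / n * (∫ θ in (-Real.pi)..Real.pi, F θ * (1 - F θ)) -
      2 * (1 + 2 * Real.pi * density F (-Real.pi)) / (Real.pi * n) * (Real.log m / m) +
        theta2 F / m ^ 2 := by
  rw [cdfAMISE, remainder]
  ring

lemma isMinOn_cdfAMISE_iff {F : ℝ → ℝ} {n : ℝ} (hn : 0 < n) (hf : 0 ≤ density F (-Real.pi))
    (hθ : 0 ≤ theta2 F) {x : ℝ} (hx : 0 < x) :
    IsMinOn (fun y => cdfAMISE F y n) (Ioi 0) x ↔
      (1 + 2 * Real.pi * density F (-Real.pi)) * (x * (Real.log x - 1)) =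
        Real.pi * theta2 F * n := by
  have hpi := Real.pi_pos
  simp only [cdfAMISE_eq]
  rw [isMinOn_sub_log_div_iff (by positivity) hθ hx]
  constructor <;> intro h
  · field_simp at h
    linarith
  · field_simp
    linarith

lemma existsUnique_isMinOn_cdfAMISE {F : ℝ → ℝ} {n : ℝ} (hn : 0 < n)
    (hf : 0 ≤ density F (-Real.pi)) (hθ : 0 ≤ theta2 F) :
    ∃! x : ℝ, 0 < x ∧ IsMinOn (fun y => cdfAMISE F y n) (Ioi 0) x := by
  have hpi := Real.pi_pos
  have hc : 0 < 1 + 2 * Real.pi * density F (-Real.pi) := by positivity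
  obtain ⟨z, hz, hzt, hlt, hgt⟩ := exists_mul_log_sub_one_eq
    (show 0 ≤ Real.pi * theta2 F * n / (1 + 2 * Real.pi * density F (-Real.pi)) by positivity)
  have hz0 : 0 < z := (Real.exp_pos 1).trans_le hz
  refine ⟨z, ⟨hz0, (isMinOn_cdfAMISE_iff hn hf hθ hz0).2 ?_⟩, fun x ⟨hx, hmin⟩ => ?_⟩
  · rw [hzt]
    field_simp
  · have h := (isMinOn_cdfAMISE_iff hn hf hθ hx).1 hmin
    have hx' : x * (Real.log x - 1) =
        Real.pi * theta2 F * n / (1 + 2 * Real.pi * density F (-Real.pi)) := by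
      rw [eq_div_iff hc.ne']
      linarith
    rcases lt_trichotomy x z with h1 | h1 | h1
    · exact absurd hx' (hlt x hx h1).ne
    · exact h1
    · exact absurd hx' (hgt x h1).ne'

/-- On [0, t] the map w e^w runs from 0 to at least t, so t has a preimage in [-1, ∞), as the chosen
inverse requires. -/
lemma lambertW0_mul_exp {t : ℝ} (ht : 0 ≤ t) :
    lambertW0 t * Real.exp (lambertW0 t) = t := by
  have hcont : ContinuousOn (fun w : ℝ => w * Real.exp w) (Icc 0 t) := by fun_prop
  obtain ⟨w, hw, hwt⟩ := intermediate_value_Icc ht hcont (show t ∈ Icc _ _ by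
    simp only [zero_mul]
    exact ⟨ht, le_mul_of_one_le_right ht (Real.one_le_exp ht)⟩)
  exact Function.invFunOn_eq (f := fun w : ℝ => w * Real.exp w)
    ⟨w, by simp only [mem_Ici]; linarith [hw.1], hwt⟩

/-- With w e^w = t/e one has t/w = e^(w+1), hence log(t/w) - 1 = w. -/
lemma div_lambertW0_spec {t : ℝ} (ht : 0 < t) :
    0 < t / lambertW0 (t / Real.exp 1) ∧
      t / lambertW0 (t / Real.exp 1) * (Real.log (t / lambertW0 (t / Real.exp 1)) - 1) = t := by
  have hte : 0 < t / Real.exp 1 := by positivity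
  have h := lambertW0_mul_exp hte.le
  set w := lambertW0 (t / Real.exp 1)
  have hw : 0 < w := by
    have := Real.exp_pos w
    by_contra! hw
    nlinarith
  have e : t / w = Real.exp (w + 1) := by
    rw [Real.exp_add, div_eq_iff hw.ne']
    rw [eq_div_iff (Real.exp_pos 1).ne'] at h
    linarith
  refine ⟨by positivity, ?_⟩
  nth_rw 2 [e]
  rw [Real.log_exp, add_sub_cancel_right]
  field_simp

lemma isMinOn_div_lambertW0 {F : ℝ → ℝ} {n c : ℝ} (hn : 0 < n)
    (hf : 0 ≤ density F (-Real.pi)) (hθ : 0 < theta2 F)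
    (hc : c = Real.pi * theta2 F / (1 + 2 * Real.pi * density F (-Real.pi))) :
    0 < c * n / lambertW0 (c * n / Real.exp 1) ∧
      IsMinOn (fun y => cdfAMISE F y n) (Ioi 0) (c * n / lambertW0 (c * n / Real.exp 1)) := by
  have hpi := Real.pi_pos
  have hcpos : 0 < c := by rw [hc]; positivity
  obtain ⟨h1, h2⟩ := div_lambertW0_spec (mul_pos hcpos hn)
  refine ⟨h1, (isMinOn_cdfAMISE_iff hn hf hθ.le h1).2 ?_⟩
  rw [h2, hc]
  field_simp

/-! ### Assembly of the error expansion. -/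

/-- Write u² - v² = 2v(u - v) + (u - v)² with u the mean and v = F. Weighting the
arithmetic–geometric inequality by m balances ∫ v²/m against m times the squared bias, which is
O(1/m²). -/
lemma IsCircularCdf.exists_abs_integral_mean_sq_sub_le {F f f' : ℝ → ℝ}
    (h : IsCircularCdf F f f') :
    ∃ C, 0 ≤ C ∧ ∀ m : ℕ, 1 ≤ m →
      |(∫ θ in (-Real.pi)..Real.pi, fejerMean f m θ ^ 2) -
        ∫ θ in (-Real.pi)..Real.pi, F θ ^ 2| ≤ C / m := by
  obtain ⟨C, hC0, hC⟩ := h.exists_integral_bias_sq_le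
  set I := ∫ θ in (-Real.pi)..Real.pi, F θ ^ 2
  have hI0 : 0 ≤ I := intervalIntegral.integral_nonneg neg_pi_lt_pi.le fun _ _ => sq_nonneg _
  refine ⟨I + 2 * C ^ 2, by positivity, fun m hm => ?_⟩
  have hm1 : (1 : ℝ) ≤ m := by exact_mod_cast hm
  have hm0 : (0 : ℝ) < m := by linarith
  set B := ∫ θ in (-Real.pi)..Real.pi, (fejerMean f m θ - F θ) ^ 2
  have hcM : ContinuousOn (fejerMean f m) (Icc (-Real.pi) Real.pi) :=
    (continuous_linearTrig _ _ _ _ _).continuousOn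
  have hiF : IntervalIntegrable (fun θ => F θ ^ 2) volume (-Real.pi) Real.pi :=
    (h.continuousOn.pow 2).intervalIntegrable_of_Icc neg_pi_lt_pi.le
  have hiM : IntervalIntegrable (fun θ => fejerMean f m θ ^ 2) volume (-Real.pi) Real.pi :=
    (hcM.pow 2).intervalIntegrable_of_Icc neg_pi_lt_pi.le
  have hiB : IntervalIntegrable (fun θ => (fejerMean f m θ - F θ) ^ 2) volume
      (-Real.pi) Real.pi :=
    ((hcM.sub h.continuousOn).pow 2).intervalIntegrable_of_Icc neg_pi_lt_pi.le
  have hB0 : 0 ≤ B := intervalIntegral.integral_nonneg neg_pi_lt_pi.le fun _ _ => sq_nonneg _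
  have hB : B ≤ C ^ 2 / m ^ 2 := by
    refine (hC m).trans ?_
    rw [div_pow]
    gcongr
    linarith
  have hbound : ‖∫ θ in (-Real.pi)..Real.pi, (fejerMean f m θ ^ 2 - F θ ^ 2)‖ ≤
      ∫ θ in (-Real.pi)..Real.pi,
        (1 / (m : ℝ) * F θ ^ 2 + ((m : ℝ) + 1) * (fejerMean f m θ - F θ) ^ 2) := by
    refine intervalIntegral.norm_integral_le_of_norm_le neg_pi_lt_pi.le
      (Eventually.of_forall fun θ _ => ?_) ((hiF.const_mul _).add (hiB.const_mul _))
    generalize fejerMean f m θ = u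
    generalize F θ = v
    have key : |2 * v * (u - v)| ≤ 1 / (m : ℝ) * v ^ 2 + m * (u - v) ^ 2 := by
      rw [abs_le]
      constructor
      · have : 0 ≤ (1 / (m : ℝ)) * (v + m * (u - v)) ^ 2 := by positivity
        have e : (1 / (m : ℝ)) * (v + m * (u - v)) ^ 2 =
          1 / (m : ℝ) * v ^ 2 + m * (u - v) ^ 2 + 2 * v * (u - v) := by
          field_simp
          ring
        linarith
      · have : 0 ≤ (1 / (m : ℝ)) * (v - m * (u - v)) ^ 2 := by positivity
        have e : (1 / (m : ℝ)) * (v - m * (u - v)) ^ 2 =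
          1 / (m : ℝ) * v ^ 2 + m * (u - v) ^ 2 - 2 * v * (u - v) := by
          field_simp
          ring
        linarith
    rw [Real.norm_eq_abs, show u ^ 2 - v ^ 2 = 2 * v * (u - v) + (u - v) ^ 2 by ring]
    refine (abs_add_le _ _).trans ?_
    rw [abs_of_nonneg (sq_nonneg (u - v))]
    linarith
  rw [intervalIntegral.integral_sub hiM hiF, intervalIntegral.integral_add (hiF.const_mul _)
    (hiB.const_mul _), intervalIntegral.integral_const_mul, intervalIntegral.integral_const_mul]
    at hbound
  refine hbound.trans ?_
  calc 1 / (m : ℝ) * I + ((m : ℝ) + 1) * B ≤ 1 / (m : ℝ) * I + (2 * m) * (C ^ 2 / m ^ 2) := by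
        gcongr
        linarith
    _ = _ := by
        field_simp

lemma IsCircularCdf.tendsto_sq_mul_integral_bias_sq {F f f' : ℝ → ℝ}
    (h : IsCircularCdf F f f') :
    Tendsto (fun m : ℕ => (m : ℝ) ^ 2 *
        ∫ x in (-Real.pi)..Real.pi, (fejerMean f m x - F x) ^ 2) atTop
      (𝓝 (1 / Real.pi * (∑' k : ℕ, (cosCoeff f (k + 1) ^ 2 + sinCoeff f (k + 1) ^ 2)) +
        2 / Real.pi * (∑' k : ℕ, (-1) ^ k * sinCoeff f (k + 1)) ^ 2)) := by
  have h1 := (tendsto_natCast_div_add_atTop (1 : ℝ)).pow 2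
  have h2 := h1.mul h.tendsto_integral_bias_sq
  rw [one_pow, one_mul] at h2
  refine h2.congr fun m => ?_
  have : (m : ℝ) + 1 ≠ 0 := by positivity
  field_simp

/-- The order of the error in an expansion whose remainders are `O(1/(mn))` and `o(1/m²)`. -/
lemma isLittleO_of_abs_le {m : ℕ → ℕ} (hm : Tendsto m atTop atTop) {E : ℕ → ℝ} {b : ℕ → ℝ}
    {C θ : ℝ} (hb : Tendsto (fun k : ℕ => (k : ℝ) ^ 2 * b k) atTop (𝓝 θ))
    (hE : ∀ n, 1 ≤ n → 1 ≤ m n →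
      |E n| ≤ C / ((m n : ℝ) * n) + |b (m n) - θ / (m n : ℝ) ^ 2|) :
    E =o[atTop] fun n : ℕ => Real.log (m n) / ((m n : ℝ) * (n : ℝ)) + 1 / (m n : ℝ) ^ 2 := by
  rw [isLittleO_iff]
  intro ε hε
  have hlog : Tendsto (fun n => Real.log (m n)) atTop atTop :=
    Real.tendsto_log_atTop.comp (tendsto_natCast_atTop_atTop.comp hm)
  have hb' := (hb.comp hm).eventually (Metric.ball_mem_nhds θ hε)
  -- Once log m ≥ C/ε, the O(1/(mn)) error is at most ε log m / (mn).
  filter_upwards [hlog.eventually_ge_atTop (C / ε), hb', eventually_ge_atTop 1,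
    hm.eventually_ge_atTop 1] with n h1 h2 hn hmn
  have hn0 : (0 : ℝ) < n := by exact_mod_cast hn
  have hm1 : (1 : ℝ) ≤ m n := by exact_mod_cast hmn
  have hm0 : (0 : ℝ) < m n := by linarith
  have hl0 : 0 ≤ Real.log (m n) := Real.log_nonneg hm1
  rw [div_le_iff₀ hε] at h1
  rw [Function.comp_apply, Real.dist_eq] at h2
  rw [Real.norm_eq_abs, Real.norm_eq_abs, abs_of_nonneg (by positivity :
    0 ≤ Real.log (m n) / ((m n : ℝ) * (n : ℝ)) + 1 / (m n : ℝ) ^ 2)]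
  refine (hE n hn hmn).trans ?_
  rw [mul_add]
  refine add_le_add ?_ ?_
  · rw [← mul_div_assoc]
    gcongr
    linarith
  · rw [show b (m n) - θ / (m n : ℝ) ^ 2 = ((m n : ℝ) ^ 2 * b (m n) - θ) / (m n : ℝ) ^ 2 by
      field_simp, abs_div, abs_of_pos (by positivity : 0 < (m n : ℝ) ^ 2), mul_one_div]
    gcongr

lemma density_nonneg_of_cdf {Ω : Type*} [MeasurableSpace Ω] {P : Measure Ω}
    [IsProbabilityMeasure P] {Y : Ω → ℝ} {F : ℝ → ℝ}
    (hcdf : ∀ θ ∈ Ico (-Real.pi) Real.pi, P.real {ω | Y ω ≤ θ} = F θ) (x : ℝ) :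
    0 ≤ density F x := by
  apply MonotoneOn.derivWithin_nonneg
  intro a ha b hb hab
  rw [← hcdf a ha, ← hcdf b hb]
  exact measureReal_mono fun ω hω => le_trans hω hab

/-- The expansion of the mean integrated squared error. -/
lemma isLittleO_cdfMISE_sub {Ω : Type*} [MeasurableSpace Ω] {P : Measure Ω}
    [IsProbabilityMeasure P] {X : ℕ → Ω → ℝ} {F f' : ℝ → ℝ}
    (h : IsCircularCdf (Function.update F Real.pi 1)
      (Function.update (density F) Real.pi (density F (-Real.pi))) f')
    (hX : ∀ i, Measurable (X i)) (hindep : iIndepFun X P)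
    (hsupp : ∀ i, ∀ᵐ ω ∂P, X i ω ∈ Ico (-Real.pi) Real.pi)
    (hcdf : ∀ i, ∀ θ ∈ Ico (-Real.pi) Real.pi, P.real {ω | X i ω ≤ θ} = F θ)
    {m : ℕ → ℕ} (hm : Tendsto m atTop atTop) :
    (fun n : ℕ => cdfMISE P X F (m n) n -
        (1 / (n : ℝ) * (∫ θ in (-Real.pi)..Real.pi, F θ * (1 - F θ)) + remainder F (m n) n))
      =o[atTop] fun n : ℕ =>
        Real.log (m n) / ((m n : ℝ) * (n : ℝ)) + 1 / (m n : ℝ) ^ 2 := by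
  have hFe := update_pi_of_mem_Ico F 1
  have hfnn : ∀ x ∈ Icc (-Real.pi) Real.pi,
      0 ≤ Function.update (density F) Real.pi (density F (-Real.pi)) x := fun x _ => by
    rw [Function.update_apply]
    split_ifs <;> exact density_nonneg_of_cdf (hcdf 0) _
  have hneg : Function.update (density F) Real.pi (density F (-Real.pi)) (-Real.pi) =
      density F (-Real.pi) := Function.update_of_ne neg_pi_lt_pi.ne _ _
  have hθ := theta2_eq h
  have hMISE : ∀ k n : ℕ, cdfMISE P X F k n = cdfMISE P X (Function.update F Real.pi 1) k n :=
    fun k n => integral_congr_ae (Eventually.of_forall fun ω =>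
      intervalIntegral_congr_Ico fun x hx => by rw [hFe x hx])
  have hFF : ∫ θ in (-Real.pi)..Real.pi, F θ * (1 - F θ) =
      (∫ θ in (-Real.pi)..Real.pi, Function.update F Real.pi 1 θ) -
        ∫ θ in (-Real.pi)..Real.pi, Function.update F Real.pi 1 θ ^ 2 := by
    have hi : IntervalIntegrable (fun θ => Function.update F Real.pi 1 θ ^ 2) volume
        (-Real.pi) Real.pi := (h.continuousOn.pow 2).intervalIntegrable_of_Icc neg_pi_lt_pi.le
    rw [← intervalIntegral.integral_sub h.sqInt.intervalIntegrable hi]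
    refine intervalIntegral_congr_Ico fun x hx => ?_
    rw [hFe x hx]
    ring
  -- From here only the properties of the completed functions matter, not their values by cases.
  generalize hf : Function.update (density F) Real.pi (density F (-Real.pi)) = f at h hfnn hneg hθ
  generalize Function.update F Real.pi 1 = G at h hFe hMISE hFF
  have hcdf' : ∀ i, ∀ θ ∈ Ico (-Real.pi) Real.pi, P.real {ω | X i ω ≤ θ} = G θ :=
    fun i θ hθ => by rw [hFe θ hθ, hcdf i θ hθ]
  obtain ⟨C₁, -, hC₁⟩ := h.exists_abs_integral_fejerCdf_sq_sub_le
  obtain ⟨C₂, -, hC₂⟩ := h.exists_abs_integral_mean_sq_sub_le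
  refine isLittleO_of_abs_le hm (C := C₁ + C₂) h.tendsto_sq_mul_integral_bias_sq
    fun n hn hmn => ?_
  have h1 := hC₁ (m n) hmn
  have h2 := hC₂ (m n) hmn
  have hn0 : (0 : ℝ) < n := by exact_mod_cast hn
  have hm0 : (0 : ℝ) < m n := by exact_mod_cast hmn
  rw [← hθ, hMISE, cdfMISE_eq h hfnn hX hindep hsupp hcdf' (m n) hn, hFF, remainder]
  rw [hneg] at h1
  generalize (∫ x in (-Real.pi)..Real.pi, f x * fejerCdfSqIntegral (m n) x) = H at h1 ⊢
  generalize (∫ θ in (-Real.pi)..Real.pi, fejerMean f (m n) θ ^ 2) = S at h2 ⊢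
  generalize (∫ θ in (-Real.pi)..Real.pi, (fejerMean f (m n) θ - G θ) ^ 2) = B
  generalize (∫ θ in (-Real.pi)..Real.pi, G θ) = I at h1 ⊢
  generalize (∫ θ in (-Real.pi)..Real.pi, G θ ^ 2) = J at h2 ⊢
  -- Three separate errors: second moment against ∫ F, squared mean against ∫ F², and squared bias
  -- against θ₂/m².
  have e : 1 / (n : ℝ) * (H - S) + B - (1 / (n : ℝ) * (I - J) +
      (-(2 * Real.log (m n) / (Real.pi * m n * n)) * (1 + 2 * Real.pi * density F (-Real.pi)) +
        theta2 F / (m n : ℝ) ^ 2)) =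
      1 / (n : ℝ) * (H - I + 2 * Real.log (m n) / (Real.pi * m n) *
        (1 + 2 * Real.pi * density F (-Real.pi))) - 1 / (n : ℝ) * (S - J) +
        (B - theta2 F / (m n : ℝ) ^ 2) := by
    field_simp
    ring
  rw [e]
  refine (abs_add_le _ _).trans (add_le_add ((abs_sub _ _).trans ?_) le_rfl)
  rw [abs_mul, abs_mul, abs_of_pos (by positivity : 0 < 1 / (n : ℝ))]
  calc _ ≤ 1 / (n : ℝ) * (C₁ / m n) + 1 / (n : ℝ) * (C₂ / m n) := by gcongr
    _ = _ := by field_simp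

end FejerCDF

end

theorem mainTheorem5 {Ω : Type*} [MeasurableSpace Ω] (P : Measure Ω) [IsProbabilityMeasure P]
    (X : ℕ → Ω → ℝ) (F : ℝ → ℝ)
    -- an i.i.d. sample on the circle `[-π, π)` with distribution function `F`
    (hX : ∀ i, Measurable (X i))
    (hindep : iIndepFun X P)
    (hsupp : ∀ i, ∀ᵐ ω ∂P, X i ω ∈ Ico (-Real.pi) Real.pi)
    (hcdf : ∀ i, ∀ θ ∈ Ico (-Real.pi) Real.pi, P.real {ω | X i ω ≤ θ} = F θ)
    (hF0 : F (-Real.pi) = 0)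
    -- `F` is twice continuously differentiable on `[-π, π)`
    (hF : ContDiffOn ℝ 2 F (Ico (-Real.pi) Real.pi))
    -- the density is continuous on the circle, with a square integrable derivative
    (hper : Tendsto (FejerCDF.density F) (𝓝[<] Real.pi) (𝓝 (FejerCDF.density F (-Real.pi))))
    (hsq : IntegrableOn
      (fun θ => derivWithin (FejerCDF.density F) (Ico (-Real.pi) Real.pi) θ ^ 2)
      (Ico (-Real.pi) Real.pi)) :
    -- the series in `θ₂(F)` converge
    (Summable (FejerCDF.theta2Single F) ∧ Summable (FejerCDF.theta2Double F)) ∧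
    -- the expansion of the mean integrated squared error
    (∀ m : ℕ → ℕ, Tendsto m atTop atTop →
      Tendsto (fun n : ℕ => (n : ℝ) / (m n : ℝ)) atTop atTop →
      (fun n : ℕ => FejerCDF.cdfMISE P X F (m n) n -
          (1 / (n : ℝ) * (∫ θ in (-Real.pi)..Real.pi, F θ * (1 - F θ)) +
            FejerCDF.remainder F (m n) n))
        =o[atTop] fun n : ℕ =>
          Real.log (m n) / ((m n : ℝ) * (n : ℝ)) + 1 / (m n : ℝ) ^ 2) ∧
    -- the optimal order
    (∀ n : ℕ, 1 ≤ n →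
      (∃! x : ℝ, 0 < x ∧ IsMinOn (fun y => FejerCDF.cdfAMISE F y n) (Ioi 0) x) ∧
      (∀ x : ℝ, 0 < x →
        (IsMinOn (fun y => FejerCDF.cdfAMISE F y n) (Ioi 0) x ↔
          (1 + 2 * Real.pi * FejerCDF.density F (-Real.pi)) * (x * (Real.log x - 1)) =
            Real.pi * FejerCDF.theta2 F * n)) ∧
      (FejerCDF.theta2 F ≠ 0 →
        ∀ c : ℝ, c = Real.pi * FejerCDF.theta2 F /
            (1 + 2 * Real.pi * FejerCDF.density F (-Real.pi)) →
          0 < c * n / FejerCDF.lambertW0 (c * n / Real.exp 1) ∧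
          IsMinOn (fun y => FejerCDF.cdfAMISE F y n) (Ioi 0)
            (c * n / FejerCDF.lambertW0 (c * n / Real.exp 1)))) := by
  have h := FejerCDF.isCircularCdf_update hF0
    (FejerCDF.tendsto_cdf_left (hX 0) (hsupp 0) (hcdf 0)) hF hper hsq
  have hf : 0 ≤ FejerCDF.density F (-Real.pi) := FejerCDF.density_nonneg_of_cdf (hcdf 0) _
  have hpi := Real.pi_pos
  -- A sum of squares plus the square of a series; nonnegativity is what makes the critical equation
  -- solvable.
  have hθ : 0 ≤ FejerCDF.theta2 F := by
    rw [FejerCDF.theta2_eq h]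
    exact add_nonneg (mul_nonneg (by positivity) (tsum_nonneg fun _ => by positivity))
      (by positivity)
  refine ⟨⟨FejerCDF.summable_theta2Single h, FejerCDF.summable_theta2Double h⟩,
    fun m hm _ => FejerCDF.isLittleO_cdfMISE_sub h hX hindep hsupp hcdf hm, fun n hn => ?_⟩
  have hn0 : (0 : ℝ) < n := by exact_mod_cast hn
  exact ⟨FejerCDF.existsUnique_isMinOn_cdfAMISE hn0 hf hθ,
    fun x hx => FejerCDF.isMinOn_cdfAMISE_iff hn0 hf hθ hx,
    fun hne c hc => FejerCDF.isMinOn_div_lambertW0 hn0 hf (lt_of_le_of_ne hθ hne.symm) hc⟩
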